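/- Let $0\le T_0<T_f$ and $X_0,X_f\in\mathbb R$. A path $x:[T_0,T_f]\to\mathbb R$ is called connecting if $x_{T_0}=X_0$ and $x_{T_f}=X_f$. For $n\ge 1$ put $\epsilon=(T_f-T_0)/n$ and $t_i=T_0+i\epsilon$ $(0\le i\le n)$. Let $X$ be a solution on $[T_0,T_f]$ of the scalar equation $dX_t=dL_t$, $X_{T_0}=X_0$ (that is, the equation $dX_t=b(X_t)\,dt+dL_t$ with $b\equiv 0$), or of $dX_t=dB_t$, $X_{T_0}=X_0$. Here $L$ is a standard symmetric $\alpha$-stable Lévy motion, i.e. a Lévy process with $\mathbb E\,e^{iuL_t}=e^{-t|u|^\alpha}$, with $0<\alpha<1$, and $B$ is a standard Brownian motion. In the stable case the transition density from $x$ to $y$ in time $t$ is written $t^{-1/\alpha}e^{-\theta_t(x,y)}$, where $\theta_t(x,y)=-\ln f_\alpha\big((y-x)/t^{1/\alpha}\big)$ and $f_\alpha(z)=\frac1{2\pi}\int_{\mathbb R} e^{-iuz}e^{-|u|^\alpha}\,du$. In the Brownian case it is written $(2\pi t)^{-1/2}e^{-\theta_t(x,y)}$, where $\theta_t(x,y)=(y-x)^2/(2t)$.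 Write $\theta_t(0)=\theta_t(x,x)$. The action quantity of a path $x$ is $\mathcal S_n(x)=\sum_{i=0}^{n-1}\theta_\epsilon(x_{t_i},x_{t_{i+1}})$. A connecting path $u$ is called a most probable transition path if, for every connecting path $x$, $$\liminf_{n\to\infty}\frac{\mathcal S_n(x)-n\theta_\epsilon(0)}{\mathcal S_n(u)-n\theta_\epsilon(0)}\ \ge\ 1,$$ in the sense that for every $c<1$ one has $c\,\big(\mathcal S_n(u)-n\theta_\epsilon(0)\big)\le \mathcal S_n(x)-n\theta_\epsilon(0)$ for all sufficiently large $n$. (i) Let $X$ be driven by $L$, with $0<\alpha<1$. For every $t^*$ with $T_0<t^*\le T_f$, the path $$X^m_t=\begin{cases}X_0,& T_0\le t<t^*,\\ X_f,& t^*\le t\le T_f,\end{cases}$$ is a most probable transition path. Conversely, every càdlàg most probable transition path is of this form for some $t^*\in(T_0,T_f]$. If $X_0\ne X_f$, the càdlàg most probable transition path is therefore not unique. (ii) Let $X$ be driven by $B$. The line segment $X^m_t=X_0+\frac{t-T_0}{T_f-T_0}(X_f-X_0)$ is a most probable transition path, and it is the only càdlàg one. Moreover, for every $n\ge1$ it minimizes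 $\mathcal S_n$ among all connecting paths. -/

import Mathlib

open MeasureTheory ProbabilityTheory Filter Topology Set
open scoped NNReal

noncomputable section

/-- A real-valued Lévy process: it starts at `0` almost surely, has independent and stationary
increments, and is stochastically continuous. -/
structure IsLevyProcess {Ω : Type*} [MeasurableSpace Ω] (L : ℝ≥0 → Ω → ℝ) (P : Measure Ω) :
    Prop where
  aemeasurable : ∀ t, AEMeasurable (L t) P
  zero : ∀ᵐ ω ∂P, L 0 ω = 0
  indep : HasIndepIncrements L P
  stationary : ∀ s t, IdentDistrib (fun ω => L (s + t) ω - L s ω) (L t) P P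
  stochCont : ∀ s, TendstoInMeasure P L (𝓝 s) (L s)

/-- A (standard) symmetric `α`-stable Lévy motion: a Lévy process with
`𝔼 [exp (i u L_t)] = exp (- t |u| ^ α)`, so that `L_1` has the law `S_α(1, 0, 0)`. -/
structure IsSymmetricStableMotion {Ω : Type*} [MeasurableSpace Ω] (α : ℝ)
    (L : ℝ≥0 → Ω → ℝ) (P : Measure Ω) : Prop where
  levy : IsLevyProcess L P
  charFun_eq : ∀ (t : ℝ≥0) (u : ℝ),
    charFun (P.map (L t)) u = Complex.exp ((-((t : ℝ) * |u| ^ α) : ℝ) : ℂ)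

/-- `X` solves `dX_t = dL_t` on `[T₀, T_f]` with `X_{T₀} = X₀`: the stochastic differential equation
`dX_t = b(X_t) dt + dL_t` with zero drift `b ≡ 0`, driven by the noise `L`. -/
def SolvesDriftless {Ω : Type*} [MeasurableSpace Ω] (P : Measure Ω) (L X : ℝ≥0 → Ω → ℝ)
    (T₀ T_f : ℝ≥0) (X₀ : ℝ) : Prop :=
  ∀ᵐ ω ∂P, ∀ t ∈ Icc T₀ T_f, X t ω = X₀ + (L t ω - L T₀ ω)

/-- The density of a probability measure on `ℝ` obtained from its characteristic function by the
inversion formula, `f(z) = (1 / 2π) ∫ exp (-i u z) ψ(u) du`. -/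
def densityOfCharFun (μ : Measure ℝ) (z : ℝ) : ℝ :=
  (2 * Real.pi)⁻¹ * (∫ u : ℝ, Complex.exp (-((u * z : ℝ) : ℂ) * Complex.I) * charFun μ u).re

/-- The transition probability density `p(y, t | x, s)` of a process `X` with independent
increments: the density of `X_t - X_s` at `y - x`. -/
def transitionDensity {Ω : Type*} [MeasurableSpace Ω] (P : Measure Ω) (X : ℝ≥0 → Ω → ℝ)
    (s t : ℝ≥0) (x y : ℝ) : ℝ :=
  densityOfCharFun (P.map (fun ω => X t ω - X s ω)) (y - x)

/-- The exponent `θ_ε(x, y)`, `ε = t - s`, in the exponential form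
`p(y, t | x, s) = N(ε) * exp (-θ_ε(x, y))` of the transition density, where `N` is the prefactor
that is split off. -/
def actionExponent {Ω : Type*} [MeasurableSpace Ω] (N : ℝ → ℝ) (P : Measure Ω)
    (X : ℝ≥0 → Ω → ℝ) (s t : ℝ≥0) (x y : ℝ) : ℝ :=
  -Real.log (transitionDensity P X s t x y / N ((t : ℝ) - (s : ℝ)))

/-- The prefactor `ε ^ (-1/α)` of the symmetric `α`-stable transition density, for which
`θ_ε(x, y) = -ln f_α((y - x) / ε ^ (1/α))`, `f_α` being the density of `S_α(1, 0, 0)`. -/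
def stablePrefactor (α ε : ℝ) : ℝ := ε ^ (-(1 / α))

/-- The prefactor `1 / √(2 π ε)` of the Brownian transition density, for which
`θ_ε(x, y) = (y - x)² / (2 ε)`. -/
def brownianPrefactor (ε : ℝ) : ℝ := (√(2 * Real.pi * ε))⁻¹

/-- The `i`-th point `t_i = T₀ + i (T_f - T₀) / n` of the equidistant partition of `[T₀, T_f]`
into `n` intervals. -/
def gridPoint (T₀ T_f : ℝ≥0) (n i : ℕ) : ℝ≥0 := T₀ + (i : ℝ≥0) / (n : ℝ≥0) * (T_f - T₀)

/-- The action quantity `S_n(x) = ∑_{i < n} θ_ε(x_{t_i}, x_{t_{i+1}})` of a path `x`. -/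
def actionQuantity {Ω : Type*} [MeasurableSpace Ω] (N : ℝ → ℝ) (P : Measure Ω)
    (X : ℝ≥0 → Ω → ℝ) (T₀ T_f : ℝ≥0) (n : ℕ) (x : ℝ≥0 → ℝ) : ℝ :=
  ∑ i ∈ Finset.range n, actionExponent N P X (gridPoint T₀ T_f n i) (gridPoint T₀ T_f n (i + 1))
    (x (gridPoint T₀ T_f n i)) (x (gridPoint T₀ T_f n (i + 1)))

/-- The renormalized action quantity `S_n(x) - n θ_ε(0)`: the action quantity of `x` minus that of
the reference path which is constantly equal to `X₀`. -/
def renormalizedAction {Ω : Type*} [MeasurableSpace Ω] (N : ℝ → ℝ) (P : Measure Ω)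
    (X : ℝ≥0 → Ω → ℝ) (T₀ T_f : ℝ≥0) (X₀ : ℝ) (n : ℕ) (x : ℝ≥0 → ℝ) : ℝ :=
  actionQuantity N P X T₀ T_f n x - actionQuantity N P X T₀ T_f n (fun _ => X₀)

/-- The set of paths that connect `(T₀, X₀)` and `(T_f, X_f)`. Only the values of a path on
`[T₀, T_f]` matter. -/
def connectingPaths (T₀ T_f : ℝ≥0) (X₀ X_f : ℝ) : Set (ℝ≥0 → ℝ) :=
  {x | x T₀ = X₀ ∧ x T_f = X_f}

/-- `u` is a most probable transition path of `X` from `(T₀, X₀)` to `(T_f, X_f)`: it connects these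
points, and for every connecting path `x`,
`liminf_{n → ∞} (S_n(x) - n θ_ε(0)) / (S_n(u) - n θ_ε(0)) ≥ 1`.
The inequality is written without the quotient, as
`c * (S_n(u) - n θ_ε(0)) ≤ S_n(x) - n θ_ε(0)` for all large `n`, for each `c < 1`; this also
makes sense where the denominator vanishes. -/
def IsMostProbablePath {Ω : Type*} [MeasurableSpace Ω] (N : ℝ → ℝ) (P : Measure Ω)
    (X : ℝ≥0 → Ω → ℝ) (T₀ T_f : ℝ≥0) (X₀ X_f : ℝ) (u : ℝ≥0 → ℝ) : Prop :=
  u ∈ connectingPaths T₀ T_f X₀ X_f ∧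
    ∀ x ∈ connectingPaths T₀ T_f X₀ X_f, ∀ c < (1 : ℝ), ∀ᶠ n : ℕ in atTop,
      c * renormalizedAction N P X T₀ T_f X₀ n u ≤ renormalizedAction N P X T₀ T_f X₀ n x

/-- A path is càdlàg on `[T₀, T_f]`: right-continuous on `[T₀, T_f)`, with left limits on
`(T₀, T_f]`. -/
def IsCadlagOn (T₀ T_f : ℝ≥0) (x : ℝ≥0 → ℝ) : Prop :=
  (∀ t ∈ Ico T₀ T_f, ContinuousWithinAt x (Ici t) t) ∧
    ∀ t ∈ Ioc T₀ T_f, ∃ l : ℝ, Tendsto x (𝓝[<] t) (𝓝 l)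

open Classical in
/-- The Heaviside-like path which is `X₀` before the time `τ` and `X_f` from `τ` on. -/
def heavisidePath (X₀ X_f : ℝ) (τ : ℝ≥0) : ℝ≥0 → ℝ := fun t => if t < τ then X₀ else X_f

/-- The line segment from `(T₀, X₀)` to `(T_f, X_f)`. -/
def segmentPath (T₀ T_f : ℝ≥0) (X₀ X_f : ℝ) : ℝ≥0 → ℝ := fun t =>
  X₀ + ((t : ℝ) - (T₀ : ℝ)) / ((T_f : ℝ) - (T₀ : ℝ)) * (X_f - X₀)

end

/-!
The transition densities depend on the increments of the noise alone, so the renormalized action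
of a path is a sum over the grid steps of a cost `φ` of the rescaled displacement.

For stable noise, `φ z = log f_α(0) - log f_α(z)` with the displacement rescaled by `(n / (T_f -
T₀)) ^ (1/α)`. Integrating the cosine transform by parts turns `f_α(z)` into a sine transform of
the decreasing function `v ^ (α - 1) * exp (-|z| ^ (-α) * v ^ α)`; as for an alternating series,
the integral lies between those over the first period and the first half-period. This gives `f_α >
0` and `f_α(z) ≍ |z| ^ (-(1 + α))`, hence `φ ≥ 0` and `φ z = (1 + α) log |z| + O(1)`
(`stableDensity_pos`, `exists_stableDensity_bounds`). A Heaviside path moves in one single step,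
so with `q = (1 + α) / α` its action is at most `q log n + O(1)`. Conversely, because `1/α > 1`,
any way of covering a fixed distance costs at least `κ log n` for every `κ < q` and large `n`
(`eventually_mul_log_le_sum`), so Heaviside paths are most probable. A càdlàg path that takes a
third value, or goes back from `X_f` to `X₀`, makes two displacements of fixed size and pays
asymptotically at least twice as much (`IsMostProbablePath.not_eventually_two_displacements`); the
remaining càdlàg paths are Heaviside paths.

For Brownian noise the action is the discrete energy `n / (2 (T_f - T₀)) * ∑ (Δx)²`. By the
Cauchy–Schwarz inequality it is at least `(X_f - X₀)² / (2 (T_f - T₀))`, which the segment attains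
on every grid, and it exceeds this value by at least `e² / (2 (T_f - T₀))` when the path deviates
by `e` from the segment at some grid point (`sq_sub_add_sq_le_mul_sum_sq`). Right-continuity turns
a deviation at one time into a deviation at grid points of all fine grids.
-/

/-! ### Sine integrals of antitone functions -/

/-- On one period starting at a zero of the sine, the first half carries the larger values of an
antitone function. -/
theorem integral_sin_sub_mul_nonneg {h : ℝ → ℝ} (hanti : AntitoneOn h (Ioi 0))
    (hint : IntegrableOn h (Ioi 0)) {a : ℝ} (ha : 0 ≤ a) :
    0 ≤ ∫ v in a..a + 2 * Real.pi, Real.sin (v - a) * h v := by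
  have hpi := Real.pi_pos
  have hi : IntervalIntegrable h volume a (a + 2 * Real.pi) := by
    rw [intervalIntegrable_iff_integrableOn_Ioc_of_le (by linarith)]
    exact hint.mono_set fun v hv => lt_of_le_of_lt ha hv.1
  have hs : IntervalIntegrable (fun v => Real.sin (v - a) * h v) volume a (a + 2 * Real.pi) :=
    hi.continuousOn_mul (by fun_prop)
  have h0 : ∫ v in a..a + 2 * Real.pi, Real.sin (v - a) * h (a + Real.pi) = 0 := by
    rw [intervalIntegral.integral_mul_const,
      intervalIntegral.integral_comp_sub_right (fun v => Real.sin v)]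
    simp
  -- The integral of the sine over a period vanishes, so the value of `h` at the midpoint may be
  -- subtracted; the integrand is then pointwise nonnegative.
  have hc : Continuous fun v => Real.sin (v - a) * h (a + Real.pi) := by fun_prop
  rw [← sub_zero (∫ v in a..a + 2 * Real.pi, Real.sin (v - a) * h v), ← h0,
    ← intervalIntegral.integral_sub hs (hc.intervalIntegrable _ _), h0,
    intervalIntegral.integral_of_le (by linarith)]
  refine setIntegral_nonneg measurableSet_Ioc fun v hv => ?_
  rw [← mul_sub]
  have hv0 : v ∈ Ioi (0 : ℝ) := lt_of_le_of_lt ha hv.1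
  have hm0 : a + Real.pi ∈ Ioi (0 : ℝ) := by simp only [mem_Ioi]; linarith
  rcases le_total v (a + Real.pi) with hle | hle
  · exact mul_nonneg (Real.sin_nonneg_of_nonneg_of_le_pi (by linarith [hv.1]) (by linarith))
      (sub_nonneg.2 (hanti hv0 hm0 hle))
  · refine mul_nonneg_of_nonpos_of_nonpos ?_ (sub_nonpos.2 (hanti hm0 hv0 hle))
    rw [← Real.sin_sub_two_pi]
    exact Real.sin_nonpos_of_nonpos_of_neg_pi_le (by linarith [hv.2]) (by linarith)

theorem integrableOn_sin_mul {h : ℝ → ℝ} (hint : IntegrableOn h (Ioi 0)) :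
    IntegrableOn (fun v => Real.sin v * h v) (Ioi 0) := by
  refine Integrable.bdd_mul (c := 1) hint (by fun_prop) (ae_of_all _ fun v => ?_)
  rw [Real.norm_eq_abs]
  exact Real.abs_sin_le_one v

theorem integral_zero_two_pi_le_integral_Ioi_sin_mul {h : ℝ → ℝ} (hanti : AntitoneOn h (Ioi 0))
    (hint : IntegrableOn h (Ioi 0)) :
    ∫ v in (0 : ℝ)..2 * Real.pi, Real.sin v * h v ≤ ∫ v in Ioi (0 : ℝ), Real.sin v * h v := by
  have hpi := Real.pi_pos
  have hsin := integrableOn_sin_mul hint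
  have hii : ∀ a b : ℝ, 0 ≤ a → 0 ≤ b →
      IntervalIntegrable (fun v => Real.sin v * h v) volume a b := fun a b ha hb => by
    rw [intervalIntegrable_iff]
    exact hsin.mono_set fun v hv => lt_of_le_of_lt (le_min ha hb) hv.1
  have hlim : Tendsto (fun n : ℕ => 2 * Real.pi + (n : ℝ) * (2 * Real.pi)) atTop atTop :=
    tendsto_atTop_add_const_left _ _
      (tendsto_natCast_atTop_atTop.atTop_mul_const (by positivity))
  refine ge_of_tendsto' (intervalIntegral_tendsto_integral_Ioi 0 hsin hlim) fun n => ?_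
  induction n with
  | zero => simp
  | succ k ih =>
    refine ih.trans ?_
    set a := 2 * Real.pi + (k : ℝ) * (2 * Real.pi) with ha
    have ha0 : 0 ≤ a := by positivity
    have hb : 2 * Real.pi + ((k + 1 : ℕ) : ℝ) * (2 * Real.pi) = a + 2 * Real.pi := by
      push_cast; ring
    rw [hb, ← intervalIntegral.integral_add_adjacent_intervals (hii 0 a le_rfl ha0)
      (hii a (a + 2 * Real.pi) ha0 (by positivity)), le_add_iff_nonneg_right]
    have hsv : ∀ v, Real.sin v = Real.sin (v - a) := fun v => by
      have : v - a = v - ((k + 1 : ℕ) : ℝ) * (2 * Real.pi) := by rw [ha]; push_cast; ring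
      rw [this, Real.sin_sub_nat_mul_two_pi]
    rw [funext fun v => congrArg (· * h v) (hsv v)]
    exact integral_sin_sub_mul_nonneg hanti hint ha0

theorem integral_Ioi_sin_mul_le_integral_zero_pi {h : ℝ → ℝ} (hanti : AntitoneOn h (Ioi 0))
    (hint : IntegrableOn h (Ioi 0)) :
    ∫ v in Ioi (0 : ℝ), Real.sin v * h v ≤ ∫ v in (0 : ℝ)..Real.pi, Real.sin v * h v := by
  have hpi := Real.pi_pos
  have hsin := integrableOn_sin_mul hint
  have hii : ∀ a b : ℝ, 0 ≤ a → 0 ≤ b →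
      IntervalIntegrable (fun v => Real.sin v * h v) volume a b := fun a b ha hb => by
    rw [intervalIntegrable_iff]
    exact hsin.mono_set fun v hv => lt_of_le_of_lt (le_min ha hb) hv.1
  have hlim : Tendsto (fun n : ℕ => Real.pi + (n : ℝ) * (2 * Real.pi)) atTop atTop :=
    tendsto_atTop_add_const_left _ _
      (tendsto_natCast_atTop_atTop.atTop_mul_const (by positivity))
  refine le_of_tendsto' (intervalIntegral_tendsto_integral_Ioi 0 hsin hlim) fun n => ?_
  induction n with
  | zero => simp
  | succ k ih =>
    refine le_trans ?_ ih
    set a := Real.pi + (k : ℝ) * (2 * Real.pi) with ha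
    have ha0 : 0 ≤ a := by positivity
    have hb : Real.pi + ((k + 1 : ℕ) : ℝ) * (2 * Real.pi) = a + 2 * Real.pi := by
      push_cast; ring
    rw [hb, ← intervalIntegral.integral_add_adjacent_intervals (hii 0 a le_rfl ha0)
      (hii a (a + 2 * Real.pi) ha0 (by positivity)), add_le_iff_nonpos_right]
    have hsv : ∀ v, Real.sin v = -Real.sin (v - a) := fun v => by
      have : v - a = v - Real.pi - (k : ℝ) * (2 * Real.pi) := by rw [ha]; ring
      rw [this, Real.sin_sub_nat_mul_two_pi, Real.sin_sub_pi, neg_neg]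
    rw [funext fun v => (congrArg (· * h v) (hsv v)).trans (neg_mul _ _),
      intervalIntegral.integral_neg, neg_nonpos]
    exact integral_sin_sub_mul_nonneg hanti hint ha0

/-! ### Tails of the symmetric stable density -/

theorem antitoneOn_rpow_mul_exp_neg {α b : ℝ} (h0 : 0 < α) (h1 : α < 1) (hb : 0 < b) :
    AntitoneOn (fun v : ℝ => v ^ (α - 1) * Real.exp (-b * v ^ α)) (Ioi 0) := by
  intro v hv w hw hvw
  have hv : 0 < v := hv
  have hp : v ^ α ≤ w ^ α := Real.rpow_le_rpow hv.le hvw h0.le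
  have : w ^ (α - 1) ≤ v ^ (α - 1) := Real.rpow_le_rpow_of_nonpos hv hvw (by linarith)
  have he : Real.exp (-b * w ^ α) ≤ Real.exp (-b * v ^ α) := by
    apply Real.exp_le_exp.2; nlinarith
  exact mul_le_mul this he (Real.exp_pos _).le (by positivity)

theorem integrableOn_rpow_sub_one_mul_exp_neg {α b : ℝ} (h0 : 0 < α) (hb : 0 < b) :
    IntegrableOn (fun v : ℝ => v ^ (α - 1) * Real.exp (-b * v ^ α)) (Ioi 0) :=
  integrableOn_rpow_mul_exp_neg_mul_rpow (by linarith) h0 hb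

theorem integrableOn_exp_neg_mul_rpow {α b : ℝ} (h0 : 0 < α) (hb : 0 < b) :
    IntegrableOn (fun v : ℝ => Real.exp (-b * v ^ α)) (Ioi 0) := by
  simpa using integrableOn_rpow_mul_exp_neg_mul_rpow (s := 0) (by norm_num) h0 hb

/-- Integration by parts trades the cosine transform for the sine transform of a function that
decreases. -/
theorem integral_cos_mul_exp_neg_mul_rpow {α b : ℝ} (h0 : 0 < α) (hb : 0 < b) :
    ∫ v in Ioi (0 : ℝ), Real.cos v * Real.exp (-b * v ^ α) =
      α * b * ∫ v in Ioi (0 : ℝ), Real.sin v * (v ^ (α - 1) * Real.exp (-b * v ^ α)) := by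
  have hE := integrableOn_exp_neg_mul_rpow h0 hb
  have hsin := integrableOn_sin_mul (integrableOn_rpow_sub_one_mul_exp_neg h0 hb)
  have hu : ∀ v ∈ Ioi (0 : ℝ), HasDerivAt (fun v : ℝ => Real.exp (-b * v ^ α))
      (-(α * b) * (v ^ (α - 1) * Real.exp (-b * v ^ α))) v := fun v hv => by
    have h := ((Real.hasDerivAt_rpow_const (p := α) (Or.inl (ne_of_gt hv))).const_mul (-b)).exp
    convert h using 1
    ring
  have hbd : ∀ v : ℝ, 0 ≤ v →
      ‖Real.exp (-b * v ^ α) * Real.sin v‖ ≤ Real.exp (-b * v ^ α) := fun v hv => by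
    rw [norm_mul, Real.norm_eq_abs, Real.norm_eq_abs, abs_of_pos (Real.exp_pos _)]
    exact mul_le_of_le_one_right (Real.exp_pos _).le (Real.abs_sin_le_one v)
  have key := integral_Ioi_mul_deriv_eq_deriv_mul (a := 0) (a' := 0) (b' := 0)
    (u := fun v : ℝ => Real.exp (-b * v ^ α)) (v := Real.sin) (v' := Real.cos)
    (u' := fun v => -(α * b) * (v ^ (α - 1) * Real.exp (-b * v ^ α)))
    hu (fun v _ => Real.hasDerivAt_sin v) ?_ ?_ ?_ ?_
  · simp_rw [mul_comm (Real.cos _)]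
    rw [key, sub_zero, zero_sub, ← integral_neg, ← integral_const_mul]
    congr 1
    ext v
    ring
  · refine Integrable.mul_bdd (c := 1) hE (by fun_prop) (ae_of_all _ fun v => ?_)
    rw [Real.norm_eq_abs]
    exact Real.abs_cos_le_one v
  · refine (hsin.const_mul (-(α * b))).congr (ae_of_all _ fun v => ?_)
    simp only [Pi.mul_apply]
    ring
  · have hc : Continuous fun v : ℝ => Real.exp (-b * v ^ α) * Real.sin v := by
      have := Real.continuous_rpow_const h0.le
      fun_prop
    have := (hc.tendsto 0).mono_left (nhdsWithin_le_nhds (s := Ioi 0))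
    simpa [Pi.mul_def] using this
  · refine squeeze_zero_norm' ((eventually_ge_atTop 0).mono fun v hv => hbd v hv) ?_
    refine Real.tendsto_exp_atBot.comp ?_
    exact (tendsto_rpow_atTop h0).const_mul_atTop_of_neg (by linarith)

/-- The density of the law `S_α(1, 0, 0)`, as a cosine transform. -/
noncomputable def stableDensity (α z : ℝ) : ℝ :=
  (2 * Real.pi)⁻¹ * ∫ u : ℝ, Real.cos (u * z) * Real.exp (-|u| ^ α)

theorem stableDensity_abs (α z : ℝ) : stableDensity α |z| = stableDensity α z := by
  unfold stableDensity
  rcases abs_choice z with h | h <;> simp [h]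

theorem stableDensity_eq_integral_Ioi (α z : ℝ) :
    stableDensity α z = Real.pi⁻¹ * ∫ u in Ioi (0 : ℝ), Real.cos (u * z) * Real.exp (-u ^ α) := by
  have h : ∀ u : ℝ, Real.cos (u * z) * Real.exp (-|u| ^ α) =
      (fun w : ℝ => Real.cos (w * z) * Real.exp (-w ^ α)) |u| := fun u => by
    rcases abs_choice u with h | h <;> simp [h]
  rw [stableDensity, integral_congr_ae (ae_of_all _ h),
    integral_comp_abs (f := fun w : ℝ => Real.cos (w * z) * Real.exp (-w ^ α)), mul_inv]
  ring

theorem stableDensity_le_zero {α : ℝ} (h0 : 0 < α) (z : ℝ) :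
    stableDensity α z ≤ stableDensity α 0 := by
  simp_rw [stableDensity_eq_integral_Ioi]
  have hE : IntegrableOn (fun v : ℝ => Real.exp (-v ^ α)) (Ioi 0) := by
    simpa using integrableOn_exp_neg_mul_rpow h0 one_pos
  refine mul_le_mul_of_nonneg_left (integral_mono ?_ (by simpa using! hE) fun u => ?_)
    (by positivity)
  · refine Integrable.bdd_mul (c := 1) hE (by fun_prop) (ae_of_all _ fun v => ?_)
    rw [Real.norm_eq_abs]
    exact Real.abs_cos_le_one _
  · simp only [mul_zero, Real.cos_zero]
    exact mul_le_mul_of_nonneg_right (Real.cos_le_one _) (Real.exp_pos _).le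

theorem stableDensity_eq_sine_transform {α z : ℝ} (h0 : 0 < α) (hz : 0 < z) :
    stableDensity α z = Real.pi⁻¹ * (α * z ^ (-(1 + α))) *
      ∫ v in Ioi (0 : ℝ), Real.sin v * (v ^ (α - 1) * Real.exp (-z ^ (-α) * v ^ α)) := by
  have hb : 0 < z ^ (-α) := Real.rpow_pos_of_pos hz _
  have hsub := integral_comp_mul_right_Ioi
    (fun v => Real.cos v * Real.exp (-z ^ (-α) * v ^ α)) 0 hz
  rw [zero_mul, integral_cos_mul_exp_neg_mul_rpow h0 hb, smul_eq_mul] at hsub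
  have hc : ∫ u in Ioi (0 : ℝ), Real.cos (u * z) * Real.exp (-u ^ α) =
      ∫ u in Ioi (0 : ℝ), Real.cos (u * z) * Real.exp (-z ^ (-α) * (u * z) ^ α) := by
    refine setIntegral_congr_fun measurableSet_Ioi fun u hu => ?_
    have hzz : z ^ (-α) * z ^ α = 1 := by rw [← Real.rpow_add hz]; simp
    rw [Real.mul_rpow (le_of_lt hu) hz.le]
    congr 2
    linear_combination (u ^ α) * hzz
  rw [stableDensity_eq_integral_Ioi, hc, hsub, neg_add, Real.rpow_add hz, Real.rpow_neg_one]
  ring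

theorem integral_sin_mul_rpow_sub_pos {α : ℝ} (h0 : 0 < α) (h1 : α < 1) :
    0 < ∫ v in (0 : ℝ)..Real.pi, Real.sin v * (v ^ (α - 1) - Real.pi ^ (α - 1)) := by
  have hi : IntervalIntegrable (fun v : ℝ => v ^ (α - 1)) volume 0 Real.pi :=
    intervalIntegral.intervalIntegrable_rpow' (by linarith)
  refine intervalIntegral.intervalIntegral_pos_of_pos_on ?_ (fun v hv => ?_) Real.pi_pos
  · exact (hi.sub intervalIntegrable_const).continuousOn_mul (by fun_prop)
  · exact mul_pos (Real.sin_pos_of_mem_Ioo hv)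
      (sub_pos.2 (Real.rpow_lt_rpow_of_neg hv.1 hv.2 (by linarith)))

theorem sine_transform_le {α b : ℝ} (h0 : 0 < α) (h1 : α < 1) (hb : 0 < b) :
    ∫ v in Ioi (0 : ℝ), Real.sin v * (v ^ (α - 1) * Real.exp (-b * v ^ α)) ≤
      ∫ v in (0 : ℝ)..Real.pi, v ^ (α - 1) := by
  have hint := integrableOn_rpow_sub_one_mul_exp_neg h0 hb
  refine (integral_Ioi_sin_mul_le_integral_zero_pi (antitoneOn_rpow_mul_exp_neg h0 h1 hb)
    hint).trans ?_
  refine intervalIntegral.integral_mono_on Real.pi_pos.le ?_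
    (intervalIntegral.intervalIntegrable_rpow' (by linarith)) fun v hv => ?_
  · rw [intervalIntegrable_iff_integrableOn_Ioc_of_le Real.pi_pos.le]
    exact (integrableOn_sin_mul hint).mono_set fun v hv => hv.1
  · have hvp : 0 ≤ v ^ (α - 1) := Real.rpow_nonneg hv.1 _
    have he : Real.exp (-b * v ^ α) ≤ 1 :=
      Real.exp_le_one_iff.2 (by nlinarith [Real.rpow_nonneg hv.1 α])
    calc Real.sin v * (v ^ (α - 1) * Real.exp (-b * v ^ α))
        ≤ 1 * (v ^ (α - 1) * Real.exp (-b * v ^ α)) :=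
          mul_le_mul_of_nonneg_right (Real.sin_le_one v) (by positivity)
      _ ≤ v ^ (α - 1) := by rw [one_mul]; exact mul_le_of_le_one_right hvp he

theorem le_sine_transform {α b : ℝ} (h0 : 0 < α) (h1 : α < 1) (hb : 0 < b) :
    Real.exp (-b * Real.pi ^ α) *
        (∫ v in (0 : ℝ)..Real.pi, Real.sin v * (v ^ (α - 1) - Real.pi ^ (α - 1))) ≤
      ∫ v in Ioi (0 : ℝ), Real.sin v * (v ^ (α - 1) * Real.exp (-b * v ^ α)) := by
  have hpi := Real.pi_pos
  set h : ℝ → ℝ := fun v => v ^ (α - 1) * Real.exp (-b * v ^ α) with hh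
  have hint : IntegrableOn h (Ioi 0) := integrableOn_rpow_sub_one_mul_exp_neg h0 hb
  have hanti : AntitoneOn h (Ioi 0) := antitoneOn_rpow_mul_exp_neg h0 h1 hb
  refine le_trans ?_ (integral_zero_two_pi_le_integral_Ioi_sin_mul hanti hint)
  have hii : ∀ a b : ℝ, 0 ≤ a → 0 ≤ b →
      IntervalIntegrable (fun v => Real.sin v * (h v - h Real.pi)) volume a b :=
    fun a b ha hb => by
      refine IntervalIntegrable.continuousOn_mul (IntervalIntegrable.sub ?_
        intervalIntegrable_const) (by fun_prop)
      rw [intervalIntegrable_iff]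
      exact hint.mono_set fun v hv => lt_of_le_of_lt (le_min ha hb) hv.1
  -- The sine integrates to zero over the period, so `h π` may be subtracted from `h`.
  have hperiod : ∫ v in (0 : ℝ)..2 * Real.pi, Real.sin v * h v =
      ∫ v in (0 : ℝ)..2 * Real.pi, Real.sin v * (h v - h Real.pi) := by
    have : ∫ v in (0 : ℝ)..2 * Real.pi, Real.sin v * h Real.pi = 0 := by
      rw [intervalIntegral.integral_mul_const]; simp
    have hc : Continuous fun v => Real.sin v * h Real.pi := by fun_prop
    refine Eq.trans ?_ ((congrArg (_ + ·) this).trans (add_zero _))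
    rw [← intervalIntegral.integral_add (hii _ _ le_rfl (by positivity))
      (hc.intervalIntegrable _ _)]
    congr 1
    ext v
    ring
  have hsecond : 0 ≤ ∫ v in Real.pi..2 * Real.pi, Real.sin v * (h v - h Real.pi) := by
    refine intervalIntegral.integral_nonneg (by linarith) fun v hv => ?_
    refine mul_nonneg_of_nonpos_of_nonpos ?_
      (sub_nonpos.2 (hanti hpi (lt_of_lt_of_le hpi hv.1) hv.1))
    rw [← Real.sin_sub_two_pi]
    exact Real.sin_nonpos_of_nonpos_of_neg_pi_le (by linarith [hv.2]) (by linarith [hv.1])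
  rw [hperiod, ← intervalIntegral.integral_add_adjacent_intervals (hii 0 Real.pi le_rfl hpi.le)
    (hii Real.pi (2 * Real.pi) hpi.le (by positivity)), ← intervalIntegral.integral_const_mul]
  refine le_add_of_le_of_nonneg ?_ hsecond
  have hi : IntervalIntegrable (fun v : ℝ => v ^ (α - 1)) volume 0 Real.pi :=
    intervalIntegral.intervalIntegrable_rpow' (by linarith)
  refine intervalIntegral.integral_mono_on_of_le_Ioo hpi.le ?_ (hii 0 Real.pi le_rfl hpi.le)
    fun v hv => ?_
  · exact ((hi.sub intervalIntegrable_const).continuousOn_mul (by fun_prop)).const_mul _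
  · have hs : 0 ≤ Real.sin v := (Real.sin_pos_of_mem_Ioo hv).le
    have he : Real.exp (-b * Real.pi ^ α) ≤ Real.exp (-b * v ^ α) := by
      apply Real.exp_le_exp.2
      nlinarith [Real.rpow_le_rpow hv.1.le hv.2.le h0.le]
    have hvp : 0 ≤ v ^ (α - 1) := Real.rpow_nonneg hv.1.le _
    rw [mul_left_comm]
    refine mul_le_mul_of_nonneg_left ?_ hs
    simp only [hh]
    nlinarith

theorem stableDensity_pos {α : ℝ} (h0 : 0 < α) (h1 : α < 1) (z : ℝ) : 0 < stableDensity α z := by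
  have hne : ∀ z : ℝ, z ≠ 0 → 0 < stableDensity α z := fun z hz => by
    have hz' : 0 < |z| := abs_pos.2 hz
    have hb : 0 < |z| ^ (-α) := Real.rpow_pos_of_pos hz' _
    rw [← stableDensity_abs, stableDensity_eq_sine_transform h0 hz']
    have := (mul_pos (Real.exp_pos (-|z| ^ (-α) * Real.pi ^ α))
      (integral_sin_mul_rpow_sub_pos h0 h1)).trans_le (le_sine_transform h0 h1 hb)
    have := Real.pi_pos
    positivity
  rcases eq_or_ne z 0 with rfl | hz
  · exact (hne 1 one_ne_zero).trans_le (stableDensity_le_zero h0 1)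
  · exact hne z hz

/-- The heavy tail of the stable density, `f_α(z) ≍ |z| ^ (-(1 + α))` as `|z| → ∞`. -/
theorem exists_stableDensity_bounds {α : ℝ} (h0 : 0 < α) (h1 : α < 1) :
    ∃ k K : ℝ, 0 < k ∧ 0 < K ∧ ∀ z : ℝ, 1 ≤ |z| →
      k * |z| ^ (-(1 + α)) ≤ stableDensity α z ∧ stableDensity α z ≤ K * |z| ^ (-(1 + α)) := by
  have hpi := Real.pi_pos
  set A := ∫ v in (0 : ℝ)..Real.pi, Real.sin v * (v ^ (α - 1) - Real.pi ^ (α - 1))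
  have hA : 0 < A := integral_sin_mul_rpow_sub_pos h0 h1
  set M := ∫ v in (0 : ℝ)..Real.pi, v ^ (α - 1)
  have hM : 0 < M := intervalIntegral.intervalIntegral_pos_of_pos_on
    (intervalIntegral.intervalIntegrable_rpow' (by linarith))
    (fun v hv => Real.rpow_pos_of_pos hv.1 _) hpi
  refine ⟨Real.pi⁻¹ * α * (Real.exp (-Real.pi ^ α) * A), Real.pi⁻¹ * α * M, by positivity,
    by positivity, fun z hz => ?_⟩
  have hz' : 0 < |z| := by linarith
  have hb : 0 < |z| ^ (-α) := Real.rpow_pos_of_pos hz' _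
  have hb1 : |z| ^ (-α) ≤ 1 := Real.rpow_le_one_of_one_le_of_nonpos hz (by linarith)
  have hp : 0 < |z| ^ (-(1 + α)) := Real.rpow_pos_of_pos hz' _
  have hpa : 0 < Real.pi ^ α := Real.rpow_pos_of_pos hpi _
  have hlow := le_sine_transform h0 h1 hb
  have hup := sine_transform_le h0 h1 hb
  have he : Real.exp (-Real.pi ^ α) ≤ Real.exp (-|z| ^ (-α) * Real.pi ^ α) :=
    Real.exp_le_exp.2 (by nlinarith)
  have hlow' := (mul_le_mul_of_nonneg_right he hA.le).trans hlow
  rw [← stableDensity_abs, stableDensity_eq_sine_transform h0 hz']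
  have hc : 0 ≤ Real.pi⁻¹ * (α * |z| ^ (-(1 + α))) := by positivity
  constructor
  · refine le_trans (le_of_eq ?_) (mul_le_mul_of_nonneg_left hlow' hc)
    ring
  · refine (mul_le_mul_of_nonneg_left hup hc).trans (le_of_eq ?_)
    ring

/-! ### Cost of a large displacement -/

/-- The excess `θ_ε(x, y) - θ_ε(0)` of the stable exponent, as a function of the rescaled
displacement `z = (y - x) / ε ^ (1/α)`. -/
noncomputable def stableCost (α z : ℝ) : ℝ :=
  Real.log (stableDensity α 0) - Real.log (stableDensity α z)

theorem stableCost_zero (α : ℝ) : stableCost α 0 = 0 := sub_self _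

theorem stableCost_nonneg {α : ℝ} (h0 : 0 < α) (h1 : α < 1) (z : ℝ) : 0 ≤ stableCost α z :=
  sub_nonneg.2 (Real.log_le_log (stableDensity_pos h0 h1 z) (stableDensity_le_zero h0 z))

theorem exists_stableCost_bounds {α : ℝ} (h0 : 0 < α) (h1 : α < 1) :
    ∃ C : ℝ, ∀ z : ℝ, 1 ≤ |z| → (1 + α) * Real.log |z| - C ≤ stableCost α z ∧
      stableCost α z ≤ (1 + α) * Real.log |z| + C := by
  obtain ⟨k, K, hk, hK, hb⟩ := exists_stableDensity_bounds h0 h1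
  refine ⟨|Real.log (stableDensity α 0)| + |Real.log k| + |Real.log K|, fun z hz => ?_⟩
  have hz' : 0 < |z| := by linarith
  have hp : 0 < |z| ^ (-(1 + α)) := Real.rpow_pos_of_pos hz' _
  obtain ⟨hl, hu⟩ := hb z hz
  have hl' := Real.log_le_log (mul_pos hk hp) hl
  have hu' := Real.log_le_log (stableDensity_pos h0 h1 z) hu
  rw [Real.log_mul hk.ne' hp.ne', Real.log_rpow hz'] at hl'
  rw [Real.log_mul hK.ne' hp.ne', Real.log_rpow hz'] at hu'
  unfold stableCost
  have e1 := abs_le.1 (le_refl |Real.log (stableDensity α 0)|)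
  have e2 := abs_le.1 (le_refl |Real.log k|)
  have e3 := abs_le.1 (le_refl |Real.log K|)
  constructor <;> linarith

theorem eventually_le_mul_log (A : ℝ) {B : ℝ} (hB : 0 < B) :
    ∀ᶠ n : ℕ in atTop, A ≤ B * Real.log n :=
  ((Real.tendsto_log_atTop.comp tendsto_natCast_atTop_atTop).const_mul_atTop
    hB).eventually_ge_atTop A

theorem log_abs_mul_rpow {β T n d : ℝ} (hT : 0 < T) (hn : 0 < n) (hd : d ≠ 0) :
    Real.log |d * (T / n) ^ (-β)| = Real.log |d| + β * (Real.log n - Real.log T) := by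
  have hs : 0 < (T / n) ^ (-β) := Real.rpow_pos_of_pos (div_pos hT hn) _
  rw [abs_mul, abs_of_pos hs, Real.log_mul (abs_ne_zero.2 hd) hs.ne',
    Real.log_rpow (div_pos hT hn), Real.log_div hT.ne' hn.ne']
  ring

/-- If the cost of a rescaled displacement grows like `p log |z|` and displacements are rescaled
by `(n / T) ^ β` with `β > 1`, then covering a fixed distance in at most `n` steps costs
asymptotically at least `κ log n` for every `κ < p β`, however the distance is split: either one
step has length at least `δ n ^ (-η)` for a small `η`, or the steps that are not much shorter than
average are so many that their bounded-below costs sum to at least a power of `n`. -/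
theorem eventually_mul_log_le_sum {φ : ℝ → ℝ} {p C β T δ κ : ℝ} (hφ : ∀ z, 0 ≤ φ z)
    (hlow : ∀ z, 1 ≤ |z| → p * Real.log |z| - C ≤ φ z) (hp : 0 < p) (hβ : 1 < β) (hT : 0 < T)
    (hδ : 0 < δ) (hκ : κ < p * β) :
    ∀ᶠ n : ℕ in atTop, ∀ (y : ℕ → ℝ) (a b : ℕ), a ≤ b → b ≤ n → δ ≤ |y b - y a| →
      κ * Real.log n ≤ ∑ i ∈ Finset.Ico a b, φ ((y (i + 1) - y i) * (T / n) ^ (-β)) := by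
  -- A step of length `δ n ^ (-η)` costs about `p (β - η) log n`, which must exceed `κ log n`.
  obtain ⟨η, hη, hη1, hηκ⟩ : ∃ η : ℝ, 0 < η ∧ η ≤ 1 ∧ κ < p * (β - η) := by
    have hd : 0 < (p * β - κ) / p := div_pos (by linarith) hp
    refine ⟨min ((p * β - κ) / p / 2) 1, by positivity, min_le_right _ _, ?_⟩
    have h1 : min ((p * β - κ) / p / 2) 1 ≤ (p * β - κ) / p / 2 := min_le_left _ _
    have h2 : p * min ((p * β - κ) / p / 2) 1 ≤ p * ((p * β - κ) / p / 2) :=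
      mul_le_mul_of_nonneg_left h1 hp.le
    have h3 : p * ((p * β - κ) / p / 2) = (p * β - κ) / 2 := by field_simp
    rw [mul_sub]
    linarith
  have hpow : ∀ᶠ n : ℕ in atTop, κ * Real.log n ≤ (n : ℝ) ^ η / 2 := by
    have h := ((isLittleO_log_rpow_atTop hη).bound
      (show (0 : ℝ) < 1 / (2 * (|κ| + 1)) by positivity))
    filter_upwards [tendsto_natCast_atTop_atTop.eventually h, eventually_ge_atTop 1] with n hn h1
    have hn1 : (1 : ℝ) ≤ n := by exact_mod_cast h1
    have hlog : 0 ≤ Real.log n := Real.log_nonneg hn1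
    have hpn : 0 ≤ (n : ℝ) ^ η := by positivity
    rw [Real.norm_of_nonneg hlog, Real.norm_of_nonneg hpn, div_mul_eq_mul_div, one_mul,
      le_div_iff₀ (by positivity)] at hn
    nlinarith [le_abs_self κ]
  filter_upwards [hpow, eventually_ge_atTop 1,
    eventually_le_mul_log (β * Real.log T - Real.log δ) (show 0 < β - η by linarith),
    eventually_le_mul_log (p * (β * Real.log T - Real.log δ) + C)
      (show 0 < p * (β - η) - κ by linarith),
    eventually_le_mul_log (β * Real.log T - Real.log (δ / 2)) (show 0 < β - 1 by linarith),
    eventually_le_mul_log (p * (β * Real.log T - Real.log (δ / 2)) + C + 1)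
      (show 0 < p * (β - 1) by nlinarith)] with n e5 hn e1 e2 e3 e4 y a b hab hbn hδy
  have hn0 : (0 : ℝ) < n := by exact_mod_cast hn
  set ℓ := Real.log n with hℓ
  have main : ∀ d r : ℝ, 0 < r → r ≤ |d| → 0 ≤ Real.log r + β * (ℓ - Real.log T) →
      p * (Real.log r + β * (ℓ - Real.log T)) - C ≤ φ (d * (T / n) ^ (-β)) := by
    intro d r hr hrd h0
    have hd : d ≠ 0 := abs_pos.1 (hr.trans_le hrd)
    have hlr := Real.log_le_log hr hrd
    have hl := log_abs_mul_rpow (β := β) hT hn0 hd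
    have hz : 1 ≤ |d * (T / n) ^ (-β)| := by
      have hpos : 0 < |d * (T / n) ^ (-β)| :=
        abs_pos.2 (mul_ne_zero hd (Real.rpow_pos_of_pos (div_pos hT hn0) _).ne')
      rw [← Real.log_nonneg_iff hpos, hl]
      linarith
    refine le_trans ?_ (hlow _ hz)
    rw [hl]
    nlinarith
  have hnη : 0 < (n : ℝ) ^ (-η) := Real.rpow_pos_of_pos hn0 _
  by_cases hbig : ∃ i ∈ Finset.Ico a b, δ * (n : ℝ) ^ (-η) ≤ |y (i + 1) - y i|
  · obtain ⟨i, hi, hle⟩ := hbig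
    have hlr : Real.log (δ * (n : ℝ) ^ (-η)) = Real.log δ - η * ℓ := by
      rw [Real.log_mul hδ.ne' hnη.ne', Real.log_rpow hn0]; ring
    have h := main _ _ (mul_pos hδ hnη) hle (by rw [hlr]; linarith)
    rw [hlr] at h
    refine le_trans ?_ (Finset.single_le_sum (fun j _ => hφ _) hi)
    linarith
  · push Not at hbig
    have hlr : Real.log (δ / 2 / n) = Real.log (δ / 2) - ℓ := by
      rw [Real.log_div (by positivity) hn0.ne']
    -- A step shorter than half the average contributes to the last summand, and any other step has
    -- length at most `δ n ^ (-η)` and cost at least `1`.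
    have hstep : ∀ i ∈ Finset.Ico a b, |y (i + 1) - y i| ≤
        δ * (n : ℝ) ^ (-η) * φ ((y (i + 1) - y i) * (T / n) ^ (-β)) + δ / 2 / n := by
      intro i hi
      rcases le_total (δ / 2 / n) |y (i + 1) - y i| with h | h
      · have h1 := main _ _ (by positivity) h (by rw [hlr]; linarith)
        rw [hlr] at h1
        have h2 : 1 ≤ φ ((y (i + 1) - y i) * (T / n) ^ (-β)) := by linarith
        have h3 := (hbig i hi).le
        have h4 : 0 ≤ δ / 2 / n := by positivity
        have h5 : 0 < δ * (n : ℝ) ^ (-η) := mul_pos hδ hnη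
        nlinarith
      · exact h.trans (le_add_of_nonneg_left (mul_nonneg (by positivity) (hφ _)))
    have htel : |y b - y a| ≤ ∑ i ∈ Finset.Ico a b, |y (i + 1) - y i| := by
      rw [← Finset.sum_Ico_sub y hab]
      exact Finset.abs_sum_le_sum_abs _ _
    have hsum := htel.trans (Finset.sum_le_sum hstep)
    rw [Finset.sum_add_distrib, ← Finset.mul_sum, Finset.sum_const, Nat.card_Ico, nsmul_eq_mul]
      at hsum
    have hcard : ((b - a : ℕ) : ℝ) * (δ / 2 / n) ≤ δ / 2 := by
      have : ((b - a : ℕ) : ℝ) ≤ n := by exact_mod_cast (Nat.sub_le b a).trans hbn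
      calc ((b - a : ℕ) : ℝ) * (δ / 2 / n) ≤ n * (δ / 2 / n) :=
            mul_le_mul_of_nonneg_right this (by positivity)
        _ = δ / 2 := by field_simp
    have hinv : (n : ℝ) ^ (-η) * (n : ℝ) ^ η = 1 := by
      rw [← Real.rpow_add hn0]; simp
    set S := ∑ i ∈ Finset.Ico a b, φ ((y (i + 1) - y i) * (T / n) ^ (-β))
    have hS : δ / 2 ≤ δ * (n : ℝ) ^ (-η) * S := by linarith
    have hS' : (1 : ℝ) / 2 ≤ (n : ℝ) ^ (-η) * S := by nlinarith
    have hnη' : 0 < (n : ℝ) ^ η := Real.rpow_pos_of_pos hn0 _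
    have : (n : ℝ) ^ η / 2 ≤ S := by
      calc (n : ℝ) ^ η / 2 = (n : ℝ) ^ η * (1 / 2) := by ring
        _ ≤ (n : ℝ) ^ η * ((n : ℝ) ^ (-η) * S) := mul_le_mul_of_nonneg_left hS' hnη'.le
        _ = (n : ℝ) ^ (-η) * (n : ℝ) ^ η * S := by ring
        _ = S := by rw [hinv, one_mul]
    exact e5.trans this

/-! ### Grid points -/

theorem coe_gridPoint {T₀ T_f : ℝ≥0} (hT : T₀ < T_f) (n i : ℕ) :
    (gridPoint T₀ T_f n i : ℝ) = T₀ + (i : ℝ) / n * ((T_f : ℝ) - T₀) := by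
  simp [gridPoint, NNReal.coe_sub hT.le]

theorem gridPoint_zero (T₀ T_f : ℝ≥0) (n : ℕ) : gridPoint T₀ T_f n 0 = T₀ := by
  simp [gridPoint]

theorem gridPoint_self {T₀ T_f : ℝ≥0} (hT : T₀ < T_f) {n : ℕ} (hn : 1 ≤ n) :
    gridPoint T₀ T_f n n = T_f := by
  have : (n : ℝ≥0) ≠ 0 := by exact_mod_cast (by omega : n ≠ 0)
  rw [gridPoint, div_self this, one_mul, add_tsub_cancel_of_le hT.le]

theorem gridPoint_mono (T₀ T_f : ℝ≥0) (n : ℕ) : Monotone (gridPoint T₀ T_f n) := by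
  intro i j hij
  have : (i : ℝ≥0) ≤ j := by exact_mod_cast hij
  unfold gridPoint
  gcongr

theorem gridPoint_mem_Icc {T₀ T_f : ℝ≥0} (hT : T₀ < T_f) {n i : ℕ} (hn : 1 ≤ n) (hi : i ≤ n) :
    gridPoint T₀ T_f n i ∈ Icc T₀ T_f := by
  constructor
  · exact (gridPoint_zero T₀ T_f n).symm.trans_le (gridPoint_mono _ _ _ (Nat.zero_le i))
  · conv_rhs => rw [← gridPoint_self hT hn]
    exact gridPoint_mono _ _ _ hi

theorem gridPoint_succ_sub {T₀ T_f : ℝ≥0} (hT : T₀ < T_f) (n i : ℕ) :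
    (gridPoint T₀ T_f n (i + 1) : ℝ) - gridPoint T₀ T_f n i = ((T_f : ℝ) - T₀) / n := by
  rw [coe_gridPoint hT, coe_gridPoint hT]
  push_cast
  ring

theorem gridPoint_lt_succ {T₀ T_f : ℝ≥0} (hT : T₀ < T_f) {n : ℕ} (hn : 1 ≤ n) (i : ℕ) :
    gridPoint T₀ T_f n i < gridPoint T₀ T_f n (i + 1) := by
  have h := gridPoint_succ_sub hT n i
  have : 0 < ((T_f : ℝ) - T₀) / n :=
    div_pos (sub_pos.2 (by exact_mod_cast hT)) (by exact_mod_cast hn)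
  rw [← NNReal.coe_lt_coe]
  linarith

/-- Fine grids have points immediately to the right of any given time before `T_f`. -/
theorem eventually_exists_gridPoint {T₀ T_f t : ℝ≥0} (ht : t ∈ Ico T₀ T_f) {p : ℝ≥0 → Prop}
    (hp : ∀ᶠ s in 𝓝[≥] t, p s) :
    ∀ᶠ n : ℕ in atTop, ∃ k ≤ n, p (gridPoint T₀ T_f n k) := by
  have hT : T₀ < T_f := ht.1.trans_lt ht.2
  obtain ⟨w, hw, hsub⟩ := mem_nhdsGE_iff_exists_Ico_subset.1 hp
  have hw : t < w := hw
  set s := min w T_f with hs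
  have hts : t < s := lt_min hw ht.2
  have hTr : (0 : ℝ) < (T_f : ℝ) - T₀ := sub_pos.2 (by exact_mod_cast hT)
  have htsr : (0 : ℝ) < (s : ℝ) - t := sub_pos.2 (by exact_mod_cast hts)
  have hsT : (s : ℝ) ≤ T_f := by exact_mod_cast min_le_right w T_f
  have htT : (T₀ : ℝ) ≤ t := by exact_mod_cast ht.1
  filter_upwards [eventually_gt_atTop ⌈((T_f : ℝ) - T₀) / (s - t)⌉₊] with n hn
  have hnr : ((T_f : ℝ) - T₀) / (s - t) < n := (Nat.le_ceil _).trans_lt (by exact_mod_cast hn)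
  have hn0 : (0 : ℝ) < n := (div_pos hTr htsr).trans hnr
  rw [div_lt_iff₀ htsr] at hnr
  set q := ((t : ℝ) - T₀) * n / (T_f - T₀) with hq
  have hq0 : 0 ≤ q := by have : 0 ≤ (t : ℝ) - T₀ := by linarith
                         positivity
  have hqe : q * ((T_f : ℝ) - T₀) = (t - T₀) * n := by rw [hq]; field_simp
  have hk1 := Nat.le_ceil q
  have hk2 := Nat.ceil_lt_add_one hq0
  have hlow : (t : ℝ) ≤ gridPoint T₀ T_f n ⌈q⌉₊ := by
    rw [coe_gridPoint hT, ← sub_le_iff_le_add', div_mul_eq_mul_div, le_div_iff₀ hn0, ← hqe]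
    exact mul_le_mul_of_nonneg_right hk1 hTr.le
  have hhigh : (gridPoint T₀ T_f n ⌈q⌉₊ : ℝ) < s := by
    rw [coe_gridPoint hT, ← lt_sub_iff_add_lt', div_mul_eq_mul_div, div_lt_iff₀ hn0]
    have := mul_lt_mul_of_pos_right hk2 hTr
    linarith
  refine ⟨⌈q⌉₊, ?_, hsub ⟨by exact_mod_cast hlow, ?_⟩⟩
  · by_contra hlt
    have hn1 : 1 ≤ n := by exact_mod_cast hn0
    have h1 := gridPoint_mono T₀ T_f n (not_le.1 hlt).le
    rw [gridPoint_self hT hn1, ← NNReal.coe_le_coe] at h1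
    linarith
  · exact lt_of_lt_of_le (by exact_mod_cast hhigh) (min_le_left w T_f)

/-! ### Action exponents of the driven processes -/

theorem map_sub_eq_of_solvesDriftless {Ω : Type*} [MeasurableSpace Ω] {P : Measure Ω}
    {L X : ℝ≥0 → Ω → ℝ} {T₀ T_f : ℝ≥0} {X₀ : ℝ} (hX : SolvesDriftless P L X T₀ T_f X₀)
    {s t : ℝ≥0} (hs : s ∈ Icc T₀ T_f) (ht : t ∈ Icc T₀ T_f) :
    P.map (fun ω => X t ω - X s ω) = P.map (fun ω => L t ω - L s ω) := by
  refine Measure.map_congr ?_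
  filter_upwards [hX] with ω hω
  rw [hω t ht, hω s hs]
  ring

theorem integrable_exp_neg_mul_abs_rpow {α ε : ℝ} (h0 : 0 < α) (hε : 0 < ε) :
    Integrable fun u : ℝ => Real.exp (-(ε * |u| ^ α)) := by
  -- A function that is not integrable has integral zero by convention; this one is positive.
  refine Integrable.of_integral_ne_zero ?_
  simp_rw [← neg_mul]
  rw [integral_comp_abs (f := fun u : ℝ => Real.exp (-ε * u ^ α)),
    integral_exp_neg_mul_rpow h0 hε]
  have := Real.rpow_pos_of_pos hε (-1 / α)
  have := Real.Gamma_pos_of_pos (show 0 < 1 / α + 1 by positivity)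
  positivity

theorem densityOfCharFun_eq_of_stable {α ε : ℝ} (h0 : 0 < α) (hε : 0 < ε) {μ : Measure ℝ}
    (hμ : ∀ u : ℝ, charFun μ u = Complex.exp ((-(ε * |u| ^ α) : ℝ) : ℂ)) (y : ℝ) :
    densityOfCharFun μ y = ε ^ (-(1 / α)) * stableDensity α (y * ε ^ (-(1 / α))) := by
  set r := ε ^ (-(1 / α)) with hr
  have hr0 : 0 < r := Real.rpow_pos_of_pos hε _
  have hnorm : ∀ u : ℝ, Complex.exp (-((u * y : ℝ) : ℂ) * Complex.I) * charFun μ u =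
      Complex.exp (((-(u * y) : ℝ) : ℂ) * Complex.I) * ((Real.exp (-(ε * |u| ^ α)) : ℝ) : ℂ) :=
    fun u => by rw [hμ]; push_cast; rfl
  have hint : Integrable fun u : ℝ =>
      Complex.exp (-((u * y : ℝ) : ℂ) * Complex.I) * charFun μ u := by
    refine (integrable_exp_neg_mul_abs_rpow h0 hε).mono' ?_ (ae_of_all _ fun u => ?_)
    · simp_rw [hnorm]
      have := (integrable_exp_neg_mul_abs_rpow h0 hε).aestronglyMeasurable
      refine AEStronglyMeasurable.mul (by fun_prop) ?_
      exact Complex.continuous_ofReal.comp_aestronglyMeasurable this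
    · rw [hnorm, norm_mul, Complex.norm_exp_ofReal_mul_I, one_mul, Complex.norm_real,
        Real.norm_of_nonneg (Real.exp_pos _).le]
  have hre : (∫ u : ℝ, Complex.exp (-((u * y : ℝ) : ℂ) * Complex.I) * charFun μ u).re =
      ∫ u : ℝ, Real.cos (u * y) * Real.exp (-(ε * |u| ^ α)) := by
    refine (integral_re hint).symm.trans (integral_congr_ae (ae_of_all _ fun u => ?_))
    simp only [hnorm]
    rw [RCLike.re_eq_complex_re, Complex.re_mul_ofReal, Complex.exp_ofReal_mul_I_re, Real.cos_neg]
  have hsub := Measure.integral_comp_mul_right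
    (fun u : ℝ => Real.cos (u * y) * Real.exp (-(ε * |u| ^ α))) r
  rw [abs_of_pos (inv_pos.2 hr0), smul_eq_mul] at hsub
  have hrα : ε * r ^ α = 1 := by
    rw [hr, ← Real.rpow_mul hε.le, neg_mul, one_div, inv_mul_cancel₀ h0.ne', Real.rpow_neg_one,
      mul_inv_cancel₀ hε.ne']
  have hsc : ∀ u : ℝ, Real.cos (u * r * y) * Real.exp (-(ε * |u * r| ^ α)) =
      Real.cos (u * (y * r)) * Real.exp (-|u| ^ α) := fun u => by
    rw [abs_mul, abs_of_pos hr0, Real.mul_rpow (abs_nonneg u) hr0.le,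
      show ε * (|u| ^ α * r ^ α) = |u| ^ α by linear_combination |u| ^ α * hrα, mul_assoc,
      mul_comm r y]
  simp_rw [hsc] at hsub
  rw [densityOfCharFun, hre, stableDensity, hsub, mul_left_comm r,
    mul_inv_cancel_left₀ hr0.ne']

theorem actionExponent_stable {Ω : Type*} [MeasurableSpace Ω] {P : Measure Ω} {α : ℝ}
    {L X : ℝ≥0 → Ω → ℝ} {T₀ T_f : ℝ≥0} {X₀ : ℝ} (h0 : 0 < α) (hL : IsSymmetricStableMotion α L P)
    (hX : SolvesDriftless P L X T₀ T_f X₀) {s t : ℝ≥0} (hs : s ∈ Icc T₀ T_f)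
    (ht : t ∈ Icc T₀ T_f) (hst : s < t) (x y : ℝ) :
    actionExponent (stablePrefactor α) P X s t x y =
      -Real.log (stableDensity α ((y - x) * ((t : ℝ) - s) ^ (-(1 / α)))) := by
  have hε : (0 : ℝ) < (t : ℝ) - s := sub_pos.2 (by exact_mod_cast hst)
  have hmap : P.map (fun ω => X t ω - X s ω) = P.map (L (t - s)) := by
    rw [map_sub_eq_of_solvesDriftless hX hs ht, ← (hL.levy.stationary s (t - s)).map_eq,
      add_tsub_cancel_of_le hst.le]
  have hchar : ∀ u : ℝ, charFun (P.map (fun ω => X t ω - X s ω)) u =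
      Complex.exp ((-(((t : ℝ) - s) * |u| ^ α) : ℝ) : ℂ) := fun u => by
    rw [hmap, hL.charFun_eq, NNReal.coe_sub hst.le]
  rw [actionExponent, transitionDensity, densityOfCharFun_eq_of_stable h0 hε hchar,
    stablePrefactor, mul_div_cancel_left₀ _ (Real.rpow_pos_of_pos hε _).ne']

theorem renormalizedAction_stable {Ω : Type*} [MeasurableSpace Ω] {P : Measure Ω} {α : ℝ}
    {L X : ℝ≥0 → Ω → ℝ} {T₀ T_f : ℝ≥0} {X₀ : ℝ} (hT : T₀ < T_f) (h0 : 0 < α)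
    (hL : IsSymmetricStableMotion α L P) (hX : SolvesDriftless P L X T₀ T_f X₀) {n : ℕ}
    (hn : 1 ≤ n) (x : ℝ≥0 → ℝ) :
    renormalizedAction (stablePrefactor α) P X T₀ T_f X₀ n x =
      ∑ i ∈ Finset.range n, stableCost α ((x (gridPoint T₀ T_f n (i + 1)) -
        x (gridPoint T₀ T_f n i)) * (((T_f : ℝ) - T₀) / n) ^ (-(1 / α))) := by
  rw [renormalizedAction, actionQuantity, actionQuantity, ← Finset.sum_sub_distrib]
  refine Finset.sum_congr rfl fun i hi => ?_
  have hi' := Finset.mem_range.1 hi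
  have hs := gridPoint_mem_Icc hT hn hi'.le
  have ht := gridPoint_mem_Icc hT hn (Nat.succ_le_of_lt hi')
  have hst := gridPoint_lt_succ hT hn i
  rw [actionExponent_stable h0 hL hX hs ht hst, actionExponent_stable h0 hL hX hs ht hst,
    gridPoint_succ_sub hT, sub_self, zero_mul, stableCost]
  ring

theorem densityOfCharFun_gaussianReal {v : ℝ≥0} (hv : 0 < v) (z : ℝ) :
    densityOfCharFun (gaussianReal 0 v) z =
      (√(2 * Real.pi * v))⁻¹ * Real.exp (-(z ^ 2 / (2 * v))) := by
  have hv' : (0 : ℝ) < v := hv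
  have hpi := Real.pi_pos
  have hb : 0 < (((v / 2 : ℝ) : ℂ)).re := by rw [Complex.ofReal_re]; positivity
  have hF := fourierIntegral_gaussian hb (-(z : ℂ))
  have hcongr : ∀ u : ℝ, Complex.exp (-((u * z : ℝ) : ℂ) * Complex.I) *
      charFun (gaussianReal 0 v) u =
      Complex.exp (Complex.I * -(z : ℂ) * u) * Complex.exp (-((v / 2 : ℝ) : ℂ) * u ^ 2) := by
    intro u
    rw [charFun_gaussianReal]
    congr 2
    · push_cast; ring
    · push_cast; simp; ring
  have hr : ((Real.pi : ℂ) / ((v / 2 : ℝ) : ℂ)) ^ (1 / 2 : ℂ) *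
      Complex.exp (-(-(z : ℂ)) ^ 2 / (4 * ((v / 2 : ℝ) : ℂ))) =
      ((√(Real.pi / (v / 2)) * Real.exp (-(z ^ 2 / (2 * v))) : ℝ) : ℂ) := by
    rw [Real.sqrt_eq_rpow, Complex.ofReal_mul, Complex.ofReal_cpow (by positivity),
      Complex.ofReal_exp]
    congr 2
    · push_cast; rfl
    · push_cast; rfl
    · push_cast; field_simp; ring
  simp_rw [densityOfCharFun, hcongr]
  rw [hF, hr, Complex.ofReal_re, ← mul_assoc]
  congr 1
  rw [show Real.pi / (v / 2) = 2 * Real.pi / v by field_simp, Real.sqrt_div (by positivity),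
    Real.sqrt_mul (by positivity) (v : ℝ)]
  have h2 := Real.mul_self_sqrt (show 0 ≤ 2 * Real.pi by positivity)
  have h3 : 0 < √(2 * Real.pi) := Real.sqrt_pos.2 (by positivity)
  have h4 : 0 < √(v : ℝ) := Real.sqrt_pos.2 hv'
  rw [mul_inv (√(2 * Real.pi)), div_eq_mul_inv, ← mul_assoc]
  congr 1
  rw [inv_mul_eq_div, div_eq_iff (by positivity), inv_mul_eq_div, eq_div_iff h3.ne', h2]

theorem actionExponent_brownian {Ω : Type*} [MeasurableSpace Ω] {P : Measure Ω}
    {B X : ℝ≥0 → Ω → ℝ} {T₀ T_f : ℝ≥0} {X₀ : ℝ} (hB : IsBrownianReal B P)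
    (hX : SolvesDriftless P B X T₀ T_f X₀) {s t : ℝ≥0} (hs : s ∈ Icc T₀ T_f)
    (ht : t ∈ Icc T₀ T_f) (hst : s < t) (x y : ℝ) :
    actionExponent brownianPrefactor P X s t x y = (y - x) ^ 2 / (2 * ((t : ℝ) - s)) := by
  have hε : 0 < t - s := tsub_pos_of_lt hst
  have hc : ((t - s : ℝ≥0) : ℝ) = (t : ℝ) - s := NNReal.coe_sub hst.le
  have hε' : (0 : ℝ) < (t : ℝ) - s := by rw [← hc]; exact hε
  have hnn : nndist t.1 s.1 = t - s := by
    ext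
    rw [coe_nndist, Real.dist_eq, hc, NNReal.val_eq_coe, NNReal.val_eq_coe, abs_of_pos hε']
  have hmap : P.map (fun ω => X t ω - X s ω) = gaussianReal 0 (t - s) := by
    rw [map_sub_eq_of_solvesDriftless hX hs ht, ← hnn]
    exact (hB.toIsPreBrownianReal.hasLaw_sub t s).map_eq
  have hpi := Real.pi_pos
  have hsq : 0 < √(2 * Real.pi * ((t : ℝ) - s)) := Real.sqrt_pos.2 (by positivity)
  rw [actionExponent, transitionDensity, hmap, densityOfCharFun_gaussianReal hε, hc,
    brownianPrefactor, mul_div_cancel_left₀ _ (inv_pos.2 hsq).ne', Real.log_exp, neg_neg]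

theorem actionQuantity_brownian {Ω : Type*} [MeasurableSpace Ω] {P : Measure Ω}
    {B X : ℝ≥0 → Ω → ℝ} {T₀ T_f : ℝ≥0} {X₀ : ℝ} (hT : T₀ < T_f) (hB : IsBrownianReal B P)
    (hX : SolvesDriftless P B X T₀ T_f X₀) {n : ℕ} (hn : 1 ≤ n) (x : ℝ≥0 → ℝ) :
    actionQuantity brownianPrefactor P X T₀ T_f n x = n / (2 * ((T_f : ℝ) - T₀)) *
      ∑ i ∈ Finset.range n,
        (x (gridPoint T₀ T_f n (i + 1)) - x (gridPoint T₀ T_f n i)) ^ 2 := by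
  rw [actionQuantity, Finset.mul_sum]
  refine Finset.sum_congr rfl fun i hi => ?_
  have hi' := Finset.mem_range.1 hi
  rw [actionExponent_brownian hB hX (gridPoint_mem_Icc hT hn hi'.le)
    (gridPoint_mem_Icc hT hn (Nat.succ_le_of_lt hi')) (gridPoint_lt_succ hT hn i),
    gridPoint_succ_sub hT]
  have hTr : (0 : ℝ) < (T_f : ℝ) - T₀ := sub_pos.2 (by exact_mod_cast hT)
  have hn0 : (0 : ℝ) < n := by exact_mod_cast hn
  field_simp

theorem renormalizedAction_brownian {Ω : Type*} [MeasurableSpace Ω] {P : Measure Ω}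
    {B X : ℝ≥0 → Ω → ℝ} {T₀ T_f : ℝ≥0} {X₀ : ℝ} (hT : T₀ < T_f) (hB : IsBrownianReal B P)
    (hX : SolvesDriftless P B X T₀ T_f X₀) {n : ℕ} (hn : 1 ≤ n) (x : ℝ≥0 → ℝ) :
    renormalizedAction brownianPrefactor P X T₀ T_f X₀ n x =
      actionQuantity brownianPrefactor P X T₀ T_f n x := by
  rw [renormalizedAction, actionQuantity_brownian hT hB hX hn (fun _ => X₀)]
  simp

/-! ### Stable noise: Heaviside paths -/

theorem heavisidePath_mem_connectingPaths {T₀ T_f τ : ℝ≥0} (hτ : τ ∈ Ioc T₀ T_f) (X₀ X_f : ℝ) :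
    heavisidePath X₀ X_f τ ∈ connectingPaths T₀ T_f X₀ X_f := by
  constructor <;> simp [heavisidePath, hτ.1, hτ.2]

theorem isCadlagOn_heavisidePath (T₀ T_f τ : ℝ≥0) (X₀ X_f : ℝ) :
    IsCadlagOn T₀ T_f (heavisidePath X₀ X_f τ) := by
  have hlt : ∀ s ∈ Iio τ, heavisidePath X₀ X_f τ s = X₀ := fun s hs => if_pos hs
  have hge : ∀ s ∈ Ici τ, heavisidePath X₀ X_f τ s = X_f := fun s hs => if_neg (not_lt.2 hs)
  refine ⟨fun t _ => ?_, fun t _ => ?_⟩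
  · rcases lt_or_ge t τ with h | h
    · refine ContinuousAt.continuousWithinAt ?_
      exact (continuousAt_const (y := X₀)).congr
        ((eventually_of_mem (Iio_mem_nhds h) hlt).mono fun _ h => h.symm)
    · refine (continuousWithinAt_const (b := X_f)).congr (fun s hs => hge s (le_trans h hs))
        (hge t h)
  · rcases le_or_gt t τ with h | h
    · refine ⟨X₀, tendsto_const_nhds.congr' ?_⟩
      filter_upwards [self_mem_nhdsWithin] with s hs
      exact (hlt s (lt_of_lt_of_le hs h)).symm
    · refine ⟨X_f, tendsto_const_nhds.congr' ?_⟩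
      filter_upwards [mem_nhdsWithin_of_mem_nhds (Ioi_mem_nhds h)] with s hs
      exact (hge s (mem_Ici.2 (le_of_lt hs))).symm

/-- On every grid, a Heaviside path makes its whole displacement within a single step. -/
theorem sum_heavisidePath {T₀ T_f τ : ℝ≥0} (hτ : τ ∈ Ioc T₀ T_f) (X₀ X_f : ℝ) {φ : ℝ → ℝ}
    (hφ : φ 0 = 0) (r : ℝ) {n : ℕ} (hn : 1 ≤ n) :
    ∑ i ∈ Finset.range n, φ ((heavisidePath X₀ X_f τ (gridPoint T₀ T_f n (i + 1)) -
        heavisidePath X₀ X_f τ (gridPoint T₀ T_f n i)) * r) = φ ((X_f - X₀) * r) := by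
  have hT : T₀ < T_f := hτ.1.trans_le hτ.2
  have hex : ∃ i, τ ≤ gridPoint T₀ T_f n i := ⟨n, by rw [gridPoint_self hT hn]; exact hτ.2⟩
  have hle : Nat.find hex ≤ n := Nat.find_min' hex (by rw [gridPoint_self hT hn]; exact hτ.2)
  have hpos : Nat.find hex ≠ 0 := fun h0 => by
    have h := Nat.find_spec hex
    rw [h0, gridPoint_zero] at h
    exact absurd hτ.1 (not_lt.2 h)
  obtain ⟨j, hj⟩ := Nat.exists_eq_succ_of_ne_zero hpos
  have hbefore : ∀ i ≤ j, heavisidePath X₀ X_f τ (gridPoint T₀ T_f n i) = X₀ := fun i hi =>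
    if_pos (not_le.1 (Nat.find_min hex (by omega)))
  have hafter : ∀ i, j + 1 ≤ i → heavisidePath X₀ X_f τ (gridPoint T₀ T_f n i) = X_f :=
    fun i hi => if_neg (not_lt.2 ((Nat.find_spec hex).trans
      (gridPoint_mono T₀ T_f n (by omega))))
  rw [Finset.sum_eq_single_of_mem j (Finset.mem_range.2 (by omega))]
  · rw [hbefore j le_rfl, hafter (j + 1) le_rfl]
  · intro i _ hij
    rcases lt_or_gt_of_ne hij with h | h
    · rw [hbefore i h.le, hbefore (i + 1) h, sub_self, zero_mul, hφ]
    · rw [hafter i h, hafter (i + 1) (by omega), sub_self, zero_mul, hφ]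

section Stable

variable {Ω : Type*} [MeasurableSpace Ω] {P : Measure Ω} {α : ℝ} {L X : ℝ≥0 → Ω → ℝ}
  {T₀ T_f : ℝ≥0} {X₀ : ℝ}

theorem renormalizedAction_stable_nonneg (hT : T₀ < T_f) (h0 : 0 < α) (h1 : α < 1)
    (hL : IsSymmetricStableMotion α L P) (hX : SolvesDriftless P L X T₀ T_f X₀) {n : ℕ}
    (hn : 1 ≤ n) (x : ℝ≥0 → ℝ) :
    0 ≤ renormalizedAction (stablePrefactor α) P X T₀ T_f X₀ n x := by
  rw [renormalizedAction_stable hT h0 hL hX hn]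
  exact Finset.sum_nonneg fun i _ => stableCost_nonneg h0 h1 _

/-- A single displacement costs at most `(1 + α) / α * log n + O(1)`. -/
theorem exists_renormalizedAction_heavisidePath_le (h0 : 0 < α) (h1 : α < 1)
    (hL : IsSymmetricStableMotion α L P) (hX : SolvesDriftless P L X T₀ T_f X₀) (X_f : ℝ)
    {τ : ℝ≥0} (hτ : τ ∈ Ioc T₀ T_f) :
    ∃ C : ℝ, ∀ᶠ n : ℕ in atTop,
      renormalizedAction (stablePrefactor α) P X T₀ T_f X₀ n (heavisidePath X₀ X_f τ) ≤
        (1 + α) * (1 / α) * Real.log n + C := by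
  have hT : T₀ < T_f := hτ.1.trans_le hτ.2
  have hTr : (0 : ℝ) < (T_f : ℝ) - T₀ := sub_pos.2 (by exact_mod_cast hT)
  have hval : ∀ {n : ℕ}, 1 ≤ n →
      renormalizedAction (stablePrefactor α) P X T₀ T_f X₀ n (heavisidePath X₀ X_f τ) =
        stableCost α ((X_f - X₀) * (((T_f : ℝ) - T₀) / n) ^ (-(1 / α))) := fun hn => by
    rw [renormalizedAction_stable hT h0 hL hX hn,
      sum_heavisidePath hτ X₀ X_f (stableCost_zero α) _ hn]
  rcases eq_or_ne (X_f - X₀) 0 with hD | hD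
  · refine ⟨0, ?_⟩
    filter_upwards [eventually_ge_atTop 1] with n hn
    rw [hval hn, hD, zero_mul, stableCost_zero, add_zero]
    have : 0 ≤ Real.log n := Real.log_nonneg (by exact_mod_cast hn)
    positivity
  · obtain ⟨C, hC⟩ := exists_stableCost_bounds h0 h1
    refine ⟨(1 + α) * (Real.log |X_f - X₀| - 1 / α * Real.log ((T_f : ℝ) - T₀)) + C, ?_⟩
    filter_upwards [eventually_ge_atTop 1, eventually_le_mul_log
      (1 / α * Real.log ((T_f : ℝ) - T₀) - Real.log |X_f - X₀|) (show 0 < 1 / α by positivity)]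
      with n hn hlog
    have hn0 : (0 : ℝ) < n := by exact_mod_cast hn
    have hl := log_abs_mul_rpow (β := 1 / α) hTr hn0 hD
    have hz : 1 ≤ |(X_f - X₀) * (((T_f : ℝ) - T₀) / n) ^ (-(1 / α))| := by
      have hpos : 0 < |(X_f - X₀) * (((T_f : ℝ) - T₀) / n) ^ (-(1 / α))| :=
        abs_pos.2 (mul_ne_zero hD (Real.rpow_pos_of_pos (div_pos hTr hn0) _).ne')
      rw [← Real.log_nonneg_iff hpos, hl]
      linarith
    rw [hval hn]
    refine ((hC _ hz).2).trans (le_of_eq ?_)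
    rw [hl]
    ring

/-- A displacement bounded below by `δ` between two grid times costs asymptotically at least as
much as a single displacement. -/
theorem eventually_mul_log_le_sum_stableCost (hT : T₀ < T_f) (h0 : 0 < α) (h1 : α < 1)
    {δ κ : ℝ} (hδ : 0 < δ) (hκ : κ < (1 + α) * (1 / α)) :
    ∀ᶠ n : ℕ in atTop, ∀ (x : ℝ≥0 → ℝ) (a b : ℕ), a ≤ b → b ≤ n →
      δ ≤ |x (gridPoint T₀ T_f n b) - x (gridPoint T₀ T_f n a)| →
      κ * Real.log n ≤ ∑ i ∈ Finset.Ico a b, stableCost α ((x (gridPoint T₀ T_f n (i + 1)) -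
        x (gridPoint T₀ T_f n i)) * (((T_f : ℝ) - T₀) / n) ^ (-(1 / α))) := by
  obtain ⟨C, hC⟩ := exists_stableCost_bounds h0 h1
  filter_upwards [eventually_mul_log_le_sum (stableCost_nonneg h0 h1) (fun z hz => (hC z hz).1)
    (show 0 < 1 + α by linarith) (show 1 < 1 / α by rw [lt_div_iff₀ h0]; linarith)
    (sub_pos.2 (by exact_mod_cast hT : (T₀ : ℝ) < T_f)) hδ hκ] with n hn x a b hab hb hd
  exact hn (fun i => x (gridPoint T₀ T_f n i)) a b hab hb hd

theorem isMostProbablePath_heavisidePath (h0 : 0 < α) (h1 : α < 1)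
    (hL : IsSymmetricStableMotion α L P) (hX : SolvesDriftless P L X T₀ T_f X₀) (X_f : ℝ)
    {τ : ℝ≥0} (hτ : τ ∈ Ioc T₀ T_f) :
    IsMostProbablePath (stablePrefactor α) P X T₀ T_f X₀ X_f (heavisidePath X₀ X_f τ) := by
  have hT : T₀ < T_f := hτ.1.trans_le hτ.2
  refine ⟨heavisidePath_mem_connectingPaths hτ X₀ X_f, fun x hx c hc => ?_⟩
  have hnn : ∀ {n : ℕ}, 1 ≤ n → ∀ y,
      0 ≤ renormalizedAction (stablePrefactor α) P X T₀ T_f X₀ n y := fun hn y =>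
    renormalizedAction_stable_nonneg hT h0 h1 hL hX hn y
  rcases le_or_gt c 0 with hc0 | hc0
  · filter_upwards [eventually_ge_atTop 1] with n hn
    exact (mul_nonpos_of_nonpos_of_nonneg hc0 (hnn hn _)).trans (hnn hn _)
  rcases eq_or_ne (X_f - X₀) 0 with hD | hD
  · filter_upwards [eventually_ge_atTop 1] with n hn
    rw [renormalizedAction_stable hT h0 hL hX hn (heavisidePath X₀ X_f τ),
      sum_heavisidePath hτ X₀ X_f (stableCost_zero α) _ hn, hD, zero_mul, stableCost_zero, mul_zero]
    exact hnn hn x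
  obtain ⟨C, hC⟩ := exists_renormalizedAction_heavisidePath_le h0 h1 hL hX X_f hτ
  have hq : 0 < (1 + α) * (1 / α) := by positivity
  set q := (1 + α) * (1 / α)
  filter_upwards [eventually_ge_atTop 1, hC,
    eventually_mul_log_le_sum_stableCost hT h0 h1 (abs_pos.2 hD)
      (show (1 + c) / 2 * q < q by nlinarith),
    eventually_le_mul_log (c * C) (show 0 < (1 - c) / 2 * q by nlinarith)] with n hn hup hlow hlog
  have h := hlow x 0 n (Nat.zero_le n) le_rfl
    (by rw [gridPoint_zero, gridPoint_self hT hn, hx.1, hx.2])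
  rw [← Finset.range_eq_Ico, ← renormalizedAction_stable hT h0 hL hX hn] at h
  have := mul_le_mul_of_nonneg_left hup hc0.le
  linarith

/-- A most probable path cannot make two displacements: they would cost asymptotically twice as much
as the single displacement of a Heaviside path. -/
theorem IsMostProbablePath.not_eventually_two_displacements (hT : T₀ < T_f) (h0 : 0 < α)
    (h1 : α < 1) (hL : IsSymmetricStableMotion α L P) (hX : SolvesDriftless P L X T₀ T_f X₀)
    {X_f : ℝ} {u : ℝ≥0 → ℝ}
    (hu : IsMostProbablePath (stablePrefactor α) P X T₀ T_f X₀ X_f u) {δ : ℝ} (hδ : 0 < δ)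
    (htwo : ∀ᶠ n : ℕ in atTop, ∃ k l, k ≤ l ∧ l ≤ n ∧ δ ≤ |u (gridPoint T₀ T_f n k) - X₀| ∧
      δ ≤ |u (gridPoint T₀ T_f n l) - u (gridPoint T₀ T_f n k)|) : False := by
  have hτ : T_f ∈ Ioc T₀ T_f := ⟨hT, le_rfl⟩
  obtain ⟨C, hC⟩ := exists_renormalizedAction_heavisidePath_le h0 h1 hL hX X_f hτ
  have hq : 0 < (1 + α) * (1 / α) := by positivity
  set q := (1 + α) * (1 / α)
  have hopt := hu.2 _ (heavisidePath_mem_connectingPaths hτ X₀ X_f) (3 / 4) (by norm_num)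
  -- Two displacements cost at least `2 * (3 / 4) * q * log n`, and `3 / 4 * (2 * (3 / 4)) > 1`.
  obtain ⟨n, hn, htwo, hC, hopt, hlow, hlog⟩ := ((eventually_ge_atTop 1).and (htwo.and (hC.and
    (hopt.and ((eventually_mul_log_le_sum_stableCost hT h0 h1 hδ
      (show 3 / 4 * q < q by linarith)).and
    (eventually_le_mul_log (C + 1) (show 0 < q / 8 by linarith))))))).exists
  obtain ⟨k, l, hkl, hln, hk, hl⟩ := htwo
  have hl1 := hlow u 0 k (Nat.zero_le k) (hkl.trans hln)
    (by rwa [gridPoint_zero, hu.1.1])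
  have hl2 := hlow u k l hkl hln hl
  have hsum := add_le_add hl1 hl2
  rw [Finset.sum_Ico_consecutive _ (Nat.zero_le k) hkl, ← Finset.range_eq_Ico] at hsum
  have hle := hsum.trans (Finset.sum_le_sum_of_subset_of_nonneg (Finset.range_mono hln)
    fun i _ _ => stableCost_nonneg h0 h1 _)
  rw [← renormalizedAction_stable hT h0 hL hX hn] at hle
  linarith

/-- A third value would be kept approximately for some time, so that the path would make one
displacement to reach it and another one to leave it. -/
theorem IsMostProbablePath.eq_or_eq (hT : T₀ < T_f) (h0 : 0 < α)
    (h1 : α < 1) (hL : IsSymmetricStableMotion α L P) (hX : SolvesDriftless P L X T₀ T_f X₀)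
    {X_f : ℝ} {u : ℝ≥0 → ℝ}
    (hu : IsMostProbablePath (stablePrefactor α) P X T₀ T_f X₀ X_f u)
    (hcad : IsCadlagOn T₀ T_f u) {t : ℝ≥0} (ht : t ∈ Icc T₀ T_f) : u t = X₀ ∨ u t = X_f := by
  by_contra! hne
  have htf : t ∈ Ico T₀ T_f := ⟨ht.1, lt_of_le_of_ne ht.2 fun h => hne.2 (by rw [h, hu.1.2])⟩
  have hδ : 0 < min (|u t - X₀|) (|X_f - u t|) / 2 := by
    have := abs_pos.2 (sub_ne_zero.2 hne.1)
    have := abs_pos.2 (sub_ne_zero.2 hne.2.symm)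
    positivity
  set δ := min (|u t - X₀|) (|X_f - u t|) / 2 with hδe
  have hnear : ∀ᶠ s in 𝓝[≥] t, |u s - u t| < δ := (Metric.tendsto_nhds.1 (hcad.1 t htf)) δ hδ
  refine hu.not_eventually_two_displacements hT h0 h1 hL hX hδ ?_
  filter_upwards [eventually_exists_gridPoint htf hnear, eventually_ge_atTop 1] with n hk hn
  obtain ⟨k, hkn, hk⟩ := hk
  refine ⟨k, n, hkn, le_rfl, ?_, ?_⟩
  · have h2 : 2 * δ ≤ |u t - X₀| := by rw [hδe]; linarith [min_le_left (|u t - X₀|) (|X_f - u t|)]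
    have h3 := abs_sub_le (u t) (u (gridPoint T₀ T_f n k)) X₀
    rw [abs_sub_comm (u t) (u _)] at h3
    linarith
  · rw [gridPoint_self hT hn, hu.1.2]
    have h2 : 2 * δ ≤ |X_f - u t| := by rw [hδe]; linarith [min_le_right (|u t - X₀|) (|X_f - u t|)]
    have h3 := abs_sub_le X_f (u (gridPoint T₀ T_f n k)) (u t)
    linarith

/-- Once a most probable path has reached `X_f`, it does not return to `X₀`. -/
theorem IsMostProbablePath.not_return (hT : T₀ < T_f) (h0 : 0 < α)
    (h1 : α < 1) (hL : IsSymmetricStableMotion α L P) (hX : SolvesDriftless P L X T₀ T_f X₀)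
    {X_f : ℝ} (hne : X₀ ≠ X_f) {u : ℝ≥0 → ℝ}
    (hu : IsMostProbablePath (stablePrefactor α) P X T₀ T_f X₀ X_f u)
    (hcad : IsCadlagOn T₀ T_f u) {s t : ℝ≥0} (hs : T₀ ≤ s) (hst : s < t) (ht : t ≤ T_f)
    (hus : u s = X_f) : u t ≠ X₀ := by
  intro hut
  have htf : t < T_f := lt_of_le_of_ne ht fun h => hne (by rw [← hut, h, hu.1.2])
  have hδ : 0 < |X_f - X₀| / 3 := by
    have := abs_pos.2 (sub_ne_zero.2 hne.symm)
    positivity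
  set δ := |X_f - X₀| / 3 with hδe
  have hD : |X_f - X₀| = 3 * δ := by rw [hδe]; ring
  have hnear : ∀ {w : ℝ≥0}, w ∈ Ico T₀ T_f → ∀ᶠ v in 𝓝[≥] w, |u v - u w| < δ := fun hw =>
    (Metric.tendsto_nhds.1 (hcad.1 _ hw)) δ hδ
  have hsI : s ∈ Ico T₀ T_f := ⟨hs, hst.trans htf⟩
  have htI : t ∈ Ico T₀ T_f := ⟨hs.trans hst.le, htf⟩
  have hbefore : ∀ᶠ v in 𝓝[≥] s, v < t := mem_nhdsWithin_of_mem_nhds (Iio_mem_nhds hst)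
  have hafter : ∀ᶠ v in 𝓝[≥] t, t ≤ v := self_mem_nhdsWithin
  refine hu.not_eventually_two_displacements hT h0 h1 hL hX hδ ?_
  filter_upwards [eventually_exists_gridPoint hsI ((hnear hsI).and hbefore),
    eventually_exists_gridPoint htI ((hnear htI).and hafter)] with n hk hl
  obtain ⟨k, hkn, hk, hkt⟩ := hk
  obtain ⟨l, hln, hl, htl⟩ := hl
  rw [hus] at hk
  rw [hut] at hl
  refine ⟨k, l, ?_, hln, ?_, ?_⟩
  · by_contra hlt
    exact absurd (htl.trans (gridPoint_mono T₀ T_f n (not_le.1 hlt).le)) (not_le.2 hkt)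
  · have h3 := abs_sub_le X_f (u (gridPoint T₀ T_f n k)) X₀
    rw [abs_sub_comm X_f (u _)] at h3
    linarith
  · have h3 := abs_sub_le X_f (u (gridPoint T₀ T_f n k)) X₀
    have h4 := abs_sub_le (u (gridPoint T₀ T_f n k)) (u (gridPoint T₀ T_f n l)) X₀
    rw [abs_sub_comm X_f (u _)] at h3
    rw [abs_sub_comm (u (gridPoint T₀ T_f n k)) (u (gridPoint T₀ T_f n l))] at h4
    linarith

theorem IsMostProbablePath.exists_eqOn_heavisidePath (hT : T₀ < T_f) (h0 : 0 < α)
    (h1 : α < 1) (hL : IsSymmetricStableMotion α L P) (hX : SolvesDriftless P L X T₀ T_f X₀)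
    {X_f : ℝ} {u : ℝ≥0 → ℝ}
    (hu : IsMostProbablePath (stablePrefactor α) P X T₀ T_f X₀ X_f u)
    (hcad : IsCadlagOn T₀ T_f u) :
    ∃ τ ∈ Ioc T₀ T_f, EqOn u (heavisidePath X₀ X_f τ) (Icc T₀ T_f) := by
  have hval := fun {t : ℝ≥0} (ht : t ∈ Icc T₀ T_f) => hu.eq_or_eq hT h0 h1 hL hX hcad ht
  rcases eq_or_ne X₀ X_f with rfl | hne
  · refine ⟨T_f, ⟨hT, le_rfl⟩, fun t ht => ?_⟩
    have := hval ht
    simp [heavisidePath, or_self_iff.1 this]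
  -- Right-continuity keeps `u` at a value that it takes for some time.
  have hright : ∀ {t : ℝ≥0}, t ∈ Ico T₀ T_f → ∃ w > t, ∀ v ∈ Ico t w, v ≤ T_f → u v = u t := by
    intro t ht
    have hδ : 0 < |X_f - X₀| := abs_pos.2 (sub_ne_zero.2 hne.symm)
    have hnear : ∀ᶠ v in 𝓝[≥] t, |u v - u t| < |X_f - X₀| :=
      (Metric.tendsto_nhds.1 (hcad.1 _ ht)) _ hδ
    obtain ⟨w, hw, hsub⟩ := mem_nhdsGE_iff_exists_Ico_subset.1 hnear
    refine ⟨w, hw, fun v hv hvf => ?_⟩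
    have hd : |u v - u t| < |X_f - X₀| := hsub hv
    rcases hval ⟨ht.1.trans hv.1, hvf⟩ with h | h <;> rcases hval ⟨ht.1, ht.2.le⟩ with h' | h'
    · exact h.trans h'.symm
    · rw [h, h', abs_sub_comm] at hd
      exact absurd hd (lt_irrefl _)
    · rw [h, h'] at hd
      exact absurd hd (lt_irrefl _)
    · exact h.trans h'.symm
  set S : Set ℝ≥0 := {t | t ∈ Icc T₀ T_f ∧ u t = X_f} with hS
  have hSne : S.Nonempty := ⟨T_f, ⟨hT.le, le_rfl⟩, hu.1.2⟩
  have hSb : BddBelow S := OrderBot.bddBelow S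
  have hle : sInf S ≤ T_f := csInf_le hSb ⟨⟨hT.le, le_rfl⟩, hu.1.2⟩
  have hlow : ∀ t ∈ Icc T₀ T_f, t < sInf S → u t = X₀ := fun t ht hlt =>
    (hval ht).resolve_right fun h => absurd (csInf_le hSb ⟨ht, h⟩) (not_le.2 hlt)
  have hgeT : T₀ ≤ sInf S := le_csInf hSne fun t ht => ht.1.1
  have hτS : u (sInf S) = X_f := by
    rcases eq_or_lt_of_le hle with h | h
    · rw [h, hu.1.2]
    · obtain ⟨w, hw, hconst⟩ := hright ⟨hgeT, h⟩
      obtain ⟨v, hv, hvw⟩ := exists_lt_of_csInf_lt hSne hw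
      rw [← hconst v ⟨csInf_le hSb hv, hvw⟩ hv.1.2, hv.2]
  have hτ0 : T₀ < sInf S := lt_of_le_of_ne hgeT fun h => hne (by rw [← hu.1.1, h, hτS])
  refine ⟨sInf S, ⟨hτ0, hle⟩, fun t ht => ?_⟩
  unfold heavisidePath
  split_ifs with h
  · exact hlow t ht h
  · rcases eq_or_lt_of_le (not_lt.1 h) with h' | h'
    · rw [← h', hτS]
    · exact (hval ht).resolve_left (hu.not_return hT h0 h1 hL hX hne hcad hgeT h' ht.2 hτS)

end Stable

/-! ### Brownian noise: the line segment -/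

/-- The discrete energy of a sequence exceeds that of the affine sequence with the same end values
by at least the square of any deviation from it. -/
theorem sq_sub_add_sq_le_mul_sum_sq (y : ℕ → ℝ) {n k : ℕ} (hn : 1 ≤ n) (hk : k ≤ n) :
    (y n - y 0) ^ 2 + (y k - (y 0 + (k : ℝ) / n * (y n - y 0))) ^ 2 ≤
      n * ∑ i ∈ Finset.range n, (y (i + 1) - y i) ^ 2 := by
  have hn0 : (0 : ℝ) < n := by exact_mod_cast hn
  set D := y n - y 0 with hD
  set Q := ∑ i ∈ Finset.range n, (y (i + 1) - y i) ^ 2 with hQ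
  have hexp : ∑ i ∈ Finset.range n, (y (i + 1) - y i - D / n) ^ 2 = Q - D ^ 2 / n := by
    have : ∀ i, (y (i + 1) - y i - D / n) ^ 2 =
        (y (i + 1) - y i) ^ 2 - 2 * (D / n) * (y (i + 1) - y i) + (D / n) ^ 2 := fun i => by ring
    simp_rw [this]
    rw [Finset.sum_add_distrib, Finset.sum_sub_distrib, ← Finset.mul_sum, Finset.sum_range_sub,
      Finset.sum_const, Finset.card_range, nsmul_eq_mul, ← hD, ← hQ]
    field_simp
    ring
  have hdev : ∑ i ∈ Finset.range k, (y (i + 1) - y i - D / n) = y k - (y 0 + (k : ℝ) / n * D) := by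
    rw [Finset.sum_sub_distrib, Finset.sum_range_sub, Finset.sum_const, Finset.card_range,
      nsmul_eq_mul]
    ring
  have hcs := sq_sum_le_card_mul_sum_sq (s := Finset.range k)
    (f := fun i => y (i + 1) - y i - D / n)
  rw [hdev, Finset.card_range] at hcs
  have hmono : ∑ i ∈ Finset.range k, (y (i + 1) - y i - D / n) ^ 2 ≤ Q - D ^ 2 / n := by
    rw [← hexp]
    exact Finset.sum_le_sum_of_subset_of_nonneg (Finset.range_mono hk) fun i _ _ => sq_nonneg _
  have hnn : 0 ≤ ∑ i ∈ Finset.range k, (y (i + 1) - y i - D / n) ^ 2 :=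
    Finset.sum_nonneg fun i _ => sq_nonneg _
  have hkn : (k : ℝ) ≤ n := by exact_mod_cast hk
  have h1 := mul_le_mul hkn hmono hnn hn0.le
  have h2 : (n : ℝ) * (Q - D ^ 2 / n) = n * Q - D ^ 2 := by field_simp
  linarith

theorem segmentPath_gridPoint {T₀ T_f : ℝ≥0} (hT : T₀ < T_f) (X₀ X_f : ℝ) (n i : ℕ) :
    segmentPath T₀ T_f X₀ X_f (gridPoint T₀ T_f n i) = X₀ + (i : ℝ) / n * (X_f - X₀) := by
  have hTr : (0 : ℝ) < (T_f : ℝ) - T₀ := sub_pos.2 (by exact_mod_cast hT)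
  rw [segmentPath, coe_gridPoint hT, add_sub_cancel_left, mul_div_cancel_right₀ _ hTr.ne']

theorem segmentPath_mem_connectingPaths {T₀ T_f : ℝ≥0} (hT : T₀ < T_f) (X₀ X_f : ℝ) :
    segmentPath T₀ T_f X₀ X_f ∈ connectingPaths T₀ T_f X₀ X_f := by
  have hTr : (0 : ℝ) < (T_f : ℝ) - T₀ := sub_pos.2 (by exact_mod_cast hT)
  constructor
  · simp [segmentPath]
  · simp [segmentPath, div_self hTr.ne']

theorem continuous_segmentPath (T₀ T_f : ℝ≥0) (X₀ X_f : ℝ) :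
    Continuous (segmentPath T₀ T_f X₀ X_f) := by
  unfold segmentPath
  fun_prop

section Brownian

variable {Ω : Type*} [MeasurableSpace Ω] {P : Measure Ω} {B X : ℝ≥0 → Ω → ℝ}
  {T₀ T_f : ℝ≥0} {X₀ X_f : ℝ}

theorem actionQuantity_segmentPath (hT : T₀ < T_f) (hB : IsBrownianReal B P)
    (hX : SolvesDriftless P B X T₀ T_f X₀) {n : ℕ} (hn : 1 ≤ n) :
    actionQuantity brownianPrefactor P X T₀ T_f n (segmentPath T₀ T_f X₀ X_f) =
      (X_f - X₀) ^ 2 / (2 * ((T_f : ℝ) - T₀)) := by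
  have hTr : (0 : ℝ) < (T_f : ℝ) - T₀ := sub_pos.2 (by exact_mod_cast hT)
  have hn0 : (0 : ℝ) < n := by exact_mod_cast hn
  have hstep : ∀ i : ℕ, (segmentPath T₀ T_f X₀ X_f (gridPoint T₀ T_f n (i + 1)) -
      segmentPath T₀ T_f X₀ X_f (gridPoint T₀ T_f n i)) ^ 2 = ((X_f - X₀) / n) ^ 2 := fun i => by
    rw [segmentPath_gridPoint hT, segmentPath_gridPoint hT]
    push_cast
    ring
  simp_rw [actionQuantity_brownian hT hB hX hn, hstep]
  rw [Finset.sum_const, Finset.card_range, nsmul_eq_mul]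
  field_simp

theorem le_actionQuantity_brownian (hT : T₀ < T_f) (hB : IsBrownianReal B P)
    (hX : SolvesDriftless P B X T₀ T_f X₀) {n k : ℕ} (hn : 1 ≤ n) (hk : k ≤ n) {x : ℝ≥0 → ℝ}
    (hx : x ∈ connectingPaths T₀ T_f X₀ X_f) :
    ((X_f - X₀) ^ 2 + (x (gridPoint T₀ T_f n k) -
        segmentPath T₀ T_f X₀ X_f (gridPoint T₀ T_f n k)) ^ 2) / (2 * ((T_f : ℝ) - T₀)) ≤
      actionQuantity brownianPrefactor P X T₀ T_f n x := by
  have hTr : (0 : ℝ) < (T_f : ℝ) - T₀ := sub_pos.2 (by exact_mod_cast hT)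
  have h := sq_sub_add_sq_le_mul_sum_sq (fun i => x (gridPoint T₀ T_f n i)) hn hk
  simp only [gridPoint_zero, gridPoint_self hT hn, hx.1, hx.2] at h
  rw [segmentPath_gridPoint hT, actionQuantity_brownian hT hB hX hn,
    div_mul_eq_mul_div (n : ℝ)]
  exact div_le_div_of_nonneg_right h (by positivity)

theorem actionQuantity_segmentPath_le (hT : T₀ < T_f) (hB : IsBrownianReal B P)
    (hX : SolvesDriftless P B X T₀ T_f X₀) {n : ℕ} (hn : 1 ≤ n) {x : ℝ≥0 → ℝ}
    (hx : x ∈ connectingPaths T₀ T_f X₀ X_f) :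
    actionQuantity brownianPrefactor P X T₀ T_f n (segmentPath T₀ T_f X₀ X_f) ≤
      actionQuantity brownianPrefactor P X T₀ T_f n x := by
  rw [actionQuantity_segmentPath hT hB hX hn]
  have hTr : (0 : ℝ) < (T_f : ℝ) - T₀ := sub_pos.2 (by exact_mod_cast hT)
  refine le_trans ?_ (le_actionQuantity_brownian hT hB hX hn (Nat.zero_le n) hx)
  gcongr
  exact le_add_of_nonneg_right (sq_nonneg _)

theorem isMostProbablePath_segmentPath (hT : T₀ < T_f) (hB : IsBrownianReal B P)
    (hX : SolvesDriftless P B X T₀ T_f X₀) :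
    IsMostProbablePath brownianPrefactor P X T₀ T_f X₀ X_f (segmentPath T₀ T_f X₀ X_f) := by
  refine ⟨segmentPath_mem_connectingPaths hT X₀ X_f, fun x hx c hc => ?_⟩
  have hTr : (0 : ℝ) < (T_f : ℝ) - T₀ := sub_pos.2 (by exact_mod_cast hT)
  filter_upwards [eventually_ge_atTop 1] with n hn
  rw [renormalizedAction_brownian hT hB hX hn, renormalizedAction_brownian hT hB hX hn]
  refine le_trans (mul_le_of_le_one_left ?_ hc.le) (actionQuantity_segmentPath_le hT hB hX hn hx)
  rw [actionQuantity_segmentPath hT hB hX hn]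
  positivity

theorem IsMostProbablePath.eqOn_segmentPath (hT : T₀ < T_f) (hB : IsBrownianReal B P)
    (hX : SolvesDriftless P B X T₀ T_f X₀) {u : ℝ≥0 → ℝ}
    (hu : IsMostProbablePath brownianPrefactor P X T₀ T_f X₀ X_f u)
    (hcad : IsCadlagOn T₀ T_f u) : EqOn u (segmentPath T₀ T_f X₀ X_f) (Icc T₀ T_f) := by
  intro t ht
  by_contra hne
  have hTr : (0 : ℝ) < (T_f : ℝ) - T₀ := sub_pos.2 (by exact_mod_cast hT)
  have hseg := segmentPath_mem_connectingPaths hT X₀ X_f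
  have htf : t ∈ Ico T₀ T_f :=
    ⟨ht.1, lt_of_le_of_ne ht.2 fun h => hne (by rw [h, hu.1.2, hseg.2])⟩
  have hd : 0 < |u t - segmentPath T₀ T_f X₀ X_f t| := abs_pos.2 (sub_ne_zero.2 hne)
  set δ := |u t - segmentPath T₀ T_f X₀ X_f t| / 2 with hδ
  have hδ0 : 0 < δ := by positivity
  have hnear : ∀ᶠ s in 𝓝[≥] t, δ < |u s - segmentPath T₀ T_f X₀ X_f s| :=
    ((hcad.1 t htf).sub (continuous_segmentPath T₀ T_f X₀ X_f).continuousWithinAt).abs.eventually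
      (lt_mem_nhds (by rw [hδ]; exact half_lt_self hd))
  -- The deviation adds a fixed amount `e` to the limiting action `A` of the segment, and `c` below
  -- is chosen so that `c * (A + e) = A + e / 2`.
  set A := (X_f - X₀) ^ 2 / (2 * ((T_f : ℝ) - T₀)) with hA
  set e := δ ^ 2 / (2 * ((T_f : ℝ) - T₀)) with he
  have hA0 : 0 ≤ A := by positivity
  have he0 : 0 < e := by positivity
  have hc1 : (A + e / 2) / (A + e) < 1 := by rw [div_lt_one (by positivity)]; linarith
  obtain ⟨n, hn, ⟨k, hkn, hk⟩, hopt⟩ := ((eventually_ge_atTop 1).and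
    ((eventually_exists_gridPoint htf hnear).and (hu.2 _ hseg _ hc1))).exists
  rw [renormalizedAction_brownian hT hB hX hn, renormalizedAction_brownian hT hB hX hn,
    actionQuantity_segmentPath hT hB hX hn, ← hA] at hopt
  have hlow : A + e ≤ actionQuantity brownianPrefactor P X T₀ T_f n u := by
    refine le_trans ?_ (le_actionQuantity_brownian hT hB hX hn hkn hu.1)
    rw [hA, he, ← add_div]
    gcongr ((X_f - X₀) ^ 2 + ?_) / _
    rw [← sq_abs (u _ - _)]
    gcongr
  have hcnn : 0 ≤ (A + e / 2) / (A + e) := by positivity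
  have h1 := (mul_le_mul_of_nonneg_left hlow hcnn).trans hopt
  rw [div_mul_cancel₀ _ (by positivity)] at h1
  linarith

end Brownian

theorem corollary1 {Ω : Type*} [MeasurableSpace Ω] (P : Measure Ω) [IsProbabilityMeasure P]
    (T₀ T_f : ℝ≥0) (hT : T₀ < T_f) (X₀ X_f : ℝ) (X : ℝ≥0 → Ω → ℝ) :
    (∀ (α : ℝ) (L : ℝ≥0 → Ω → ℝ), 0 < α → α < 1 → IsSymmetricStableMotion α L P →
      SolvesDriftless P L X T₀ T_f X₀ →
        (∀ τ ∈ Ioc T₀ T_f,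
          IsMostProbablePath (stablePrefactor α) P X T₀ T_f X₀ X_f (heavisidePath X₀ X_f τ)) ∧
        (∀ u : ℝ≥0 → ℝ, IsCadlagOn T₀ T_f u →
          IsMostProbablePath (stablePrefactor α) P X T₀ T_f X₀ X_f u →
            ∃ τ ∈ Ioc T₀ T_f, EqOn u (heavisidePath X₀ X_f τ) (Icc T₀ T_f)) ∧
        (X₀ ≠ X_f → ∃ u v : ℝ≥0 → ℝ, IsCadlagOn T₀ T_f u ∧ IsCadlagOn T₀ T_f v ∧
          IsMostProbablePath (stablePrefactor α) P X T₀ T_f X₀ X_f u ∧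
          IsMostProbablePath (stablePrefactor α) P X T₀ T_f X₀ X_f v ∧
          ¬ EqOn u v (Icc T₀ T_f))) ∧
    (∀ B : ℝ≥0 → Ω → ℝ, IsBrownianReal B P → SolvesDriftless P B X T₀ T_f X₀ →
        IsMostProbablePath brownianPrefactor P X T₀ T_f X₀ X_f (segmentPath T₀ T_f X₀ X_f) ∧
        (∀ u : ℝ≥0 → ℝ, IsCadlagOn T₀ T_f u →
          IsMostProbablePath brownianPrefactor P X T₀ T_f X₀ X_f u →
            EqOn u (segmentPath T₀ T_f X₀ X_f) (Icc T₀ T_f)) ∧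
        (∀ n : ℕ, 1 ≤ n → ∀ x ∈ connectingPaths T₀ T_f X₀ X_f,
          actionQuantity brownianPrefactor P X T₀ T_f n (segmentPath T₀ T_f X₀ X_f) ≤
            actionQuantity brownianPrefactor P X T₀ T_f n x)) := by
  refine ⟨fun α L h0 h1 hL hX => ⟨fun τ hτ => isMostProbablePath_heavisidePath h0 h1 hL hX X_f hτ,
    fun u hcad hu => hu.exists_eqOn_heavisidePath hT h0 h1 hL hX hcad, fun hne => ?_⟩,
    fun B hB hX => ⟨isMostProbablePath_segmentPath hT hB hX,
      fun u hcad hu => hu.eqOn_segmentPath hT hB hX hcad,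
      fun n hn x hx => actionQuantity_segmentPath_le hT hB hX hn hx⟩⟩
  obtain ⟨τ, hτ⟩ := exists_between hT
  refine ⟨heavisidePath X₀ X_f τ, heavisidePath X₀ X_f T_f, isCadlagOn_heavisidePath ..,
    isCadlagOn_heavisidePath .., isMostProbablePath_heavisidePath h0 h1 hL hX X_f ⟨hτ.1, hτ.2.le⟩,
    isMostProbablePath_heavisidePath h0 h1 hL hX X_f ⟨hT, le_rfl⟩, fun heq => hne ?_⟩
  have h := heq ⟨hτ.1.le, hτ.2.le⟩
  simpa [heavisidePath, hτ.2] using h.symm
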